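/- Let $dA=\pi^{-1}\,dx\,dy$ on $\mathbb C$, $\partial=\frac12(\partial_x-i\partial_y)$, $\bar\partial=\frac12(\partial_x+i\partial_y)$, $\Delta=\partial\bar\partial$, and $\mathbb D(a,\rho)=\{z:|z-a|<\rho\}$. A function on an open set is called bianalytic if it is continuous and satisfies $\bar\partial^2 f=0$ in the sense of distributions. Let $Q:\mathbb C\to\mathbb R$ be continuous, $z_0\in\mathbb C$, and let $r>0$ be such that, with $D=\mathbb D(z_0,r)$: 1. $Q$ is real-analytic in $D$, and $\Delta Q>\epsilon$ on $D$ for some $\epsilon>0$; 2. there is a polarization of $Q$ in $D$, i.e. a function $(z,w)\mapsto Q(z,w)$ on $D\times D$ that is analytic in $z$, anti-analytic in $w$, and satisfies $Q(z,z)=Q(z)$; 3. for all $z,w\in D$ we have $b(z,w):=\partial_z\bar\partial_wQ(z,w)\ne0$ and $\bar\partial_w\theta(z,w)\neq 0$, where $\theta(z,w)=\frac{Q(w)-Q(z,w)}{w-z}$ for $z\neq w$ and $\theta(w,w)=\partial_zQ(z,w)|_{z=w}$; 4. $2\,\mathrm{Re}\,Q(z,w)-Q(w)-Q(z)\le-\frac12\Delta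 Q(z_0)|w-z|^2$ for all $z,w\in D$. Fix a smooth function $\chi_0:\mathbb R\to[0,\infty)$ that equals $1$ on $(-\frac23,\frac23)$ and has its support in $(-1,1)$, and put $\chi(w)=\chi_0(|w-z_0|/r)$. For $m\ge1$ and $z,w\in D$ let $$K^{(2)}_{2,m}(z,w)=\Big\{-m^2|z-w|^2b^2+m\Big[2b+(z-w)\partial_zb-(\bar z-\bar w)\bar\partial_wb+|z-w|^2\Big(-\tfrac32\bar\partial_w\partial_zb+\frac{\partial_zb\cdot\bar\partial_wb}{b}\Big)\Big]\Big\}e^{mQ(z,w)}.$$ Then $K^{(2)}_{2,m}$ is a local bianalytic Bergman kernel $\mathrm{mod}(m^{-1/2})$; that is: (a) for every $m\ge1$, $K^{(2)}_{2,m}(z,w)$ is bianalytic in $z\in D$ for each fixed $w\in D$, and, for each fixed $z\in D$, it is real-analytic in $w\in D$ and satisfies $\partial_w^2K^{(2)}_{2,m}(z,w)=0$; (b) there is a constant $C$ such that for all real $m\ge1$, all bianalytic $u:\mathbb C\to\mathbb C$ with $\|u\|_m^2:=\int_{\mathbb C}|u|^2e^{-mQ}\,dA<\infty$, and all $z\in\mathbb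 D(z_0,\frac13r)$, $$\Big|u(z)-\int_{D}u(w)\chi(w)K^{(2)}_{2,m}(z,w)e^{-mQ(w)}\,dA(w)\Big|\le C\,\|u\|_m\,e^{\frac12mQ(z)}\,m^{-1/2}.$$ -/

import Mathlib

noncomputable section

namespace LocalBergman

/-- The Wirtinger derivative `∂ = (∂_x - i ∂_y) / 2`. -/
def wirt (f : ℂ → ℂ) (z : ℂ) : ℂ :=
  (fderiv ℝ f z 1 - Complex.I * fderiv ℝ f z Complex.I) / 2

/-- The Wirtinger derivative `∂̄ = (∂_x + i ∂_y) / 2`. -/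
def wirtBar (f : ℂ → ℂ) (z : ℂ) : ℂ :=
  (fderiv ℝ f z 1 + Complex.I * fderiv ℝ f z Complex.I) / 2

/-- `ΔQ = ∂ ∂̄ Q`, a quarter of the usual Laplacian. -/
def lapl (Q : ℂ → ℝ) (z : ℂ) : ℝ :=
  (wirt (wirtBar fun ζ => (Q ζ : ℂ)) z).re

/-- The normalized area measure `dA = π⁻¹ dx dy`. -/
def areaMeasure : MeasureTheory.Measure ℂ :=
  ENNReal.ofReal Real.pi⁻¹ • MeasureTheory.volume

/-- Complex-valued test functions with compact support in `U`. -/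
structure IsTest (U : Set ℂ) (φ : ℂ → ℂ) : Prop where
  smooth : ContDiff ℝ ((⊤ : ℕ∞) : WithTop ℕ∞) φ
  compact : HasCompactSupport φ
  supp : tsupport φ ⊆ U

/-- `f` is `q`-analytic on `U`: continuous, with `∂̄^q f = 0` in the sense of distributions. -/
def IsPolyanalyticOn (q : ℕ) (f : ℂ → ℂ) (U : Set ℂ) : Prop :=
  ContinuousOn f U ∧
    ∀ φ : ℂ → ℂ, IsTest U φ → ∫ w, f w * (wirtBar^[q] φ) w ∂areaMeasure = 0

/-- `f` is `q`-analytic in the conjugate variable on `U`: continuous, with `∂^q f = 0` in the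
sense of distributions. -/
def IsConjPolyanalyticOn (q : ℕ) (f : ℂ → ℂ) (U : Set ℂ) : Prop :=
  ContinuousOn f U ∧
    ∀ φ : ℂ → ℂ, IsTest U φ → ∫ w, f w * (wirt^[q] φ) w ∂areaMeasure = 0

/-- The space `A²_{q,mQ}` of `q`-analytic functions on `ℂ` that belong to `L²(e^{-mQ} dA)`. -/
def bergmanSpace (q : ℕ) (m : ℝ) (Q : ℂ → ℝ) : Set (ℂ → ℂ) :=
  {u | IsPolyanalyticOn q u Set.univ ∧
    MeasureTheory.Integrable (fun w => ‖u w‖ ^ 2 * Real.exp (-(m * Q w))) areaMeasure}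

/-- The norm of `L²(e^{-mQ} dA)`. -/
def weightedNorm (m : ℝ) (Q : ℂ → ℝ) (u : ℂ → ℂ) : ℝ :=
  Real.sqrt (∫ w, ‖u w‖ ^ 2 * Real.exp (-(m * Q w)) ∂areaMeasure)

/-- `P` is a polarization of `Q` on the disk `𝔻(z₀, r)`: analytic in the first variable,
anti-analytic in the second one, and equal to `Q` on the diagonal. -/
structure IsPolarization (Q : ℂ → ℝ) (P : ℂ → ℂ → ℂ) (z₀ : ℂ) (r : ℝ) : Prop where
  analytic_fst : ∀ w ∈ Metric.ball z₀ r,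
    AnalyticOnNhd ℂ (fun z => P z w) (Metric.ball z₀ r)
  antianalytic_snd : ∀ z ∈ Metric.ball z₀ r,
    AnalyticOnNhd ℂ (fun w => starRingEnd ℂ (P z w)) (Metric.ball z₀ r)
  diag : ∀ z ∈ Metric.ball z₀ r, P z z = (Q z : ℂ)

/-- `b(z, w) = ∂_z ∂̄_w P(z, w)`. -/
def bfun (P : ℂ → ℂ → ℂ) (z w : ℂ) : ℂ :=
  wirt (fun ζ => wirtBar (fun ω => P ζ ω) w) z

/-- The phase function `θ(z, w) = (Q(w) - P(z, w)) / (w - z)`, continued to the diagonal by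
`θ(w, w) = (∂_z P)(w, w)`. -/
def phase (Q : ℂ → ℝ) (P : ℂ → ℂ → ℂ) (z w : ℂ) : ℂ :=
  open Classical in
  if z = w then wirt (fun ζ => P ζ w) w else ((Q w : ℂ) - P z w) / (w - z)

/-- The requirements on the radius `r` of the disk around `z₀`. -/
structure IsAdmissible (Q : ℂ → ℝ) (P : ℂ → ℂ → ℂ) (z₀ : ℂ) (r : ℝ) : Prop where
  radius_pos : 0 < r
  analytic : AnalyticOnNhd ℝ Q (Metric.ball z₀ r)
  lapl_bound : ∃ ε : ℝ, 0 < ε ∧ ∀ z ∈ Metric.ball z₀ r, ε < lapl Q z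
  polarization : IsPolarization Q P z₀ r
  bfun_ne : ∀ z ∈ Metric.ball z₀ r, ∀ w ∈ Metric.ball z₀ r, bfun P z w ≠ 0
  phase_ne : ∀ z ∈ Metric.ball z₀ r, ∀ w ∈ Metric.ball z₀ r,
    wirtBar (fun ω => phase Q P z ω) w ≠ 0
  decay : ∀ z ∈ Metric.ball z₀ r, ∀ w ∈ Metric.ball z₀ r,
    2 * (P z w).re - Q w - Q z ≤ -(1 / 2) * lapl Q z₀ * ‖w - z‖ ^ 2

/-- The profile of the cut-off function: smooth, non-negative, equal to `1` on `(-2/3, 2/3)`, with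
support in `(-1, 1)`. -/
structure IsCutoffProfile (χ₀ : ℝ → ℝ) : Prop where
  smooth : ContDiff ℝ ((⊤ : ℕ∞) : WithTop ℕ∞) χ₀
  nonneg : ∀ t, 0 ≤ χ₀ t
  eq_one : ∀ t ∈ Set.Ioo (-(2 / 3) : ℝ) (2 / 3), χ₀ t = 1
  supp : tsupport χ₀ ⊆ Set.Ioo (-1) 1

/-- The cut-off function `χ(w) = χ₀(|w - z₀| / r)`. -/
def cutoff (χ₀ : ℝ → ℝ) (z₀ : ℂ) (r : ℝ) (w : ℂ) : ℝ := χ₀ (‖w - z₀‖ / r)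

/-- The family `L m` is a local `q`-analytic reproducing kernel modulo `err m` on `𝔻(z₀, r)`.
The constant `C` does not depend on `m`, `u` and `z`. -/
structure IsLocalReproducingKernel (q : ℕ) (Q : ℂ → ℝ) (z₀ : ℂ) (r : ℝ) (χ₀ : ℝ → ℝ)
    (err : ℝ → ℝ) (L : ℝ → ℂ → ℂ → ℂ) : Prop where
  polyanalytic_fst : ∀ m : ℝ, 1 ≤ m → ∀ w ∈ Metric.ball z₀ r,
    IsPolyanalyticOn q (fun z => L m z w) (Metric.ball z₀ r)
  analytic_snd : ∀ m : ℝ, 1 ≤ m → ∀ z ∈ Metric.ball z₀ r,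
    AnalyticOnNhd ℝ (fun w => L m z w) (Metric.ball z₀ r)
  reproducing : ∃ C : ℝ, ∀ m : ℝ, 1 ≤ m → ∀ u ∈ bergmanSpace q m Q,
    ∀ z ∈ Metric.ball z₀ (r / 3),
      ‖u z - ∫ w in Metric.ball z₀ r,
          u w * (cutoff χ₀ z₀ r w : ℂ) * L m z w * (Real.exp (-(m * Q w)) : ℂ) ∂areaMeasure‖
        ≤ C * (weightedNorm m Q u * Real.exp (m * Q z / 2) * err m)

/-- A local `q`-analytic Bergman kernel modulo `err m`: a local `q`-analytic reproducing kernel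
that is `q`-analytic in the conjugate of the second variable. -/
structure IsLocalBergmanKernel (q : ℕ) (Q : ℂ → ℝ) (z₀ : ℂ) (r : ℝ) (χ₀ : ℝ → ℝ)
    (err : ℝ → ℝ) (L : ℝ → ℂ → ℂ → ℂ) : Prop
    extends IsLocalReproducingKernel q Q z₀ r χ₀ err L where
  conjPolyanalytic_snd : ∀ m : ℝ, 1 ≤ m → ∀ z ∈ Metric.ball z₀ r,
    IsConjPolyanalyticOn q (fun w => L m z w) (Metric.ball z₀ r)

/-- The coefficient `-|z-w|² b²` of `m²`. -/
def coeff0 (P : ℂ → ℂ → ℂ) (z w : ℂ) : ℂ :=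
  -((‖z - w‖ : ℂ) ^ 2) * bfun P z w ^ 2

/-- The coefficient
`2b + (z-w) ∂_z b - (z̄-w̄) ∂̄_w b + |z-w|² (-(3/2) ∂̄_w ∂_z b + ∂_z b · ∂̄_w b / b)` of `m`. -/
def coeff1 (P : ℂ → ℂ → ℂ) (z w : ℂ) : ℂ :=
  2 * bfun P z w
    + (z - w) * wirt (fun ζ => bfun P ζ w) z
    - (starRingEnd ℂ z - starRingEnd ℂ w) * wirtBar (fun ω => bfun P z ω) w
    + (‖z - w‖ : ℂ) ^ 2 *
      (-(3 / 2) * wirtBar (fun ω => wirt (fun ζ => bfun P ζ ω) z) w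
        + wirt (fun ζ => bfun P ζ w) z * wirtBar (fun ω => bfun P z ω) w / bfun P z w)

/-- The two-term kernel `(m² coeff0 + m coeff1) e^{m P(z, w)}`. -/
def twoTermKernel (P : ℂ → ℂ → ℂ) (m : ℝ) (z w : ℂ) : ℂ :=
  ((m : ℂ) ^ 2 * coeff0 P z w + (m : ℂ) * coeff1 P z w) * Complex.exp ((m : ℂ) * P z w)

end LocalBergman

end

/-!
The kernel `(w̄ - z̄) / (w - z)` is a fundamental solution of `∂̄²` (for `dA`), so for `u`
bianalytic and a test function `G` the value `u z * G z` is an integral of `u` against `∂̄ G` and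
`∂̄² G`. Take `G = X H e^{m (P(z, ·) - Q)}` with a cut-off `X` equal to `1` near `z` and
`H w = 1 - (∂_z b / b)(z, z) (w - z)`. Both `∂̄ G` and `∂̄² G` are `e^{m (P(z, ·) - Q)}` times an
amplitude which is explicit in the `w̄`-derivatives of `P` at `(w, w)` and `(z, w)`. Taylor
expansion along the diagonal shows that, up to the sign, this amplitude is that of the two-term
kernel with an error `O(t + t²)`, `t = m |w - z|²`; the linear factor `H` is what makes the terms
of order `m |w - z|` and `m² |w - z|³` agree. Since `2 Re P(z, w) - Q w - Q z ≤ -κ |w - z|²`, the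
exponential contributes `e^{-κ t / 2}`, which absorbs `t + t²`, and Cauchy–Schwarz against the
remaining Gaussian, of `L²`-norm `O(m^{-1/2})`, bounds the error.

A polarization is only assumed separately holomorphic in `(z, w̄)`. Its real part is bounded above
by the decay hypothesis, hence it is locally bounded by Borel–Carathéodory and jointly holomorphic
by Osgood's lemma.
-/

noncomputable section

open Metric Filter Topology Set ComplexConjugate MeasureTheory Asymptotics
open scoped ContDiff

namespace LocalBergman

section TwoVariables

variable {E : Type*} [NormedAddCommGroup E] [NormedSpace ℂ E]
  {f : ℂ × ℂ → E} {Ω : Set (ℂ × ℂ)} {p : ℂ × ℂ}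

/-- The partial derivative of `f` in its first complex variable. -/
def partialFst (f : ℂ × ℂ → E) (p : ℂ × ℂ) : E := deriv (fun z => f (z, p.2)) p.1

/-- The partial derivative of `f` in its second complex variable. -/
def partialSnd (f : ℂ × ℂ → E) (p : ℂ × ℂ) : E := deriv (fun v => f (p.1, v)) p.2

lemma hasDerivAt_partialFst (hf : DifferentiableAt ℂ f p) :
    HasDerivAt (fun z => f (z, p.2)) (partialFst f p) p.1 :=
  (hf.comp (f := fun z => (z, p.2)) p.1 (by fun_prop)).hasDerivAt

lemma hasDerivAt_partialSnd (hf : DifferentiableAt ℂ f p) :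
    HasDerivAt (fun v => f (p.1, v)) (partialSnd f p) p.2 :=
  (hf.comp (f := fun v => (p.1, v)) p.2 (by fun_prop)).hasDerivAt

lemma dist_le_of_norm_le_on_ball {g : ℂ → E} {c z : ℂ} {R M : ℝ}
    (hg : DifferentiableOn ℂ g (ball c R)) (hM : ∀ x ∈ ball c R, ‖g x‖ ≤ M) (hz : z ∈ ball c R) :
    dist (g z) (g c) ≤ 2 * M / R * dist z c := by
  refine Complex.dist_le_div_mul_dist_of_mapsTo_ball hg (fun x hx => ?_) hz
  have hR : 0 < R := pos_of_mem_ball hz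
  rw [mem_closedBall, dist_eq_norm]
  linarith [norm_sub_le (g x) (g c), hM x hx, hM c (mem_ball_self hR)]

/-- By the Schwarz lemma, local boundedness makes the second-variable slices locally
equi-Lipschitz. -/
lemma continuousOn_of_separately_differentiableAt (hΩ : IsOpen Ω)
    (hfst : ∀ p ∈ Ω, DifferentiableAt ℂ (fun z => f (z, p.2)) p.1)
    (hsnd : ∀ p ∈ Ω, DifferentiableAt ℂ (fun v => f (p.1, v)) p.2)
    (hbdd : ∀ p ∈ Ω, ∃ M, ∀ᶠ q in 𝓝 p, ‖f q‖ ≤ M) : ContinuousOn f Ω := by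
  intro p hp
  apply ContinuousAt.continuousWithinAt
  obtain ⟨M, hM⟩ := hbdd p hp
  obtain ⟨ε, hε, hball⟩ := Metric.eventually_nhds_iff_ball.1 (hM.and (hΩ.mem_nhds hp))
  have hslice : Tendsto (fun q : ℂ × ℂ => f (q.1, p.2)) (𝓝 p) (𝓝 (f p)) :=
    (hfst p hp).continuousAt.tendsto.comp continuousAt_fst
  have hdiff : Tendsto (fun q : ℂ × ℂ => f q - f (q.1, p.2)) (𝓝 p) (𝓝 0) := by
    apply squeeze_zero_norm' (a := fun q : ℂ × ℂ => 2 * M / ε * dist q.2 p.2)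
    · filter_upwards [ball_mem_nhds p hε] with q hq
      have hmem : ∀ v ∈ ball p.2 ε, (q.1, v) ∈ ball p ε := fun v hv =>
        (ball_prod_same p.1 p.2 ε).subset ⟨(max_lt_iff.1 (mem_ball.1 hq)).1, hv⟩
      rw [← dist_eq_norm]
      exact dist_le_of_norm_le_on_ball
        (fun v hv => (hsnd _ (hball _ (hmem v hv)).2).differentiableWithinAt)
        (fun v hv => (hball _ (hmem v hv)).1) (max_lt_iff.1 (mem_ball.1 hq)).2
    · have : Continuous fun q : ℂ × ℂ => 2 * M / ε * dist q.2 p.2 := by fun_prop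
      simpa using this.tendsto p
  simpa [ContinuousAt] using hdiff.add hslice

omit [NormedSpace ℂ E] in
lemma tendstoLocallyUniformlyOn_slice {U V : Set ℂ} (hU : IsOpen U) (hV : IsOpen V)
    (hf : ContinuousOn f (U ×ˢ V)) {v : ℂ} (hv : v ∈ V) :
    TendstoLocallyUniformlyOn (fun w z => f (z, w)) (fun z => f (z, v)) (𝓝 v) U := by
  refine hU.tendstoLocallyUniformlyOn_iff_forall_tendsto.2 fun z hz => ?_
  have hzv : ContinuousAt f (z, v) := hf.continuousAt ((hU.prod hV).mem_nhds ⟨hz, hv⟩)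
  have hpair : ContinuousAt (fun q : ℂ × ℂ => (f (q.2, v), f (q.2, q.1))) (v, z) :=
    (ContinuousAt.comp (f := fun q : ℂ × ℂ => (q.2, v)) hzv (by fun_prop)).prodMk
      (ContinuousAt.comp (f := fun q : ℂ × ℂ => (q.2, q.1)) hzv (by fun_prop))
  rw [← nhds_prod_eq]
  exact hpair.tendsto.mono_right (nhds_le_uniformity _)

variable [CompleteSpace E]

lemma continuousAt_partialFst (hΩ : IsOpen Ω) (hf : ContinuousOn f Ω)
    (hfst : ∀ p ∈ Ω, DifferentiableAt ℂ (fun z => f (z, p.2)) p.1) (hp : p ∈ Ω) :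
    ContinuousAt (partialFst f) p := by
  obtain ⟨U, V, hU, hpU, hV, hpV, hUV⟩ := mem_nhds_prod_iff'.1 (hΩ.mem_nhds hp)
  have hdiff : ∀ v ∈ V, DifferentiableOn ℂ (fun z => f (z, v)) U := fun v hv z hz =>
    (hfst (z, v) (hUV ⟨hz, hv⟩)).differentiableWithinAt
  have hlim := (tendstoLocallyUniformlyOn_slice hU hV (hf.mono hUV) hpV).deriv
    ((hV.eventually_mem hpV).mono hdiff) hU
  have hlim' : TendstoLocallyUniformlyOn (fun q z => partialFst f (z, q.2))
    (fun z => partialFst f (z, p.2)) (𝓝 p) U := fun u hu z hz =>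
      let ⟨t, ht, h⟩ := hlim u hu z hz
      ⟨t, ht, continuousAt_snd.eventually h⟩
  have hcont := ((hdiff p.2 hpV).deriv hU).continuousOn
  exact hlim'.tendsto_comp (hcont p.1 hpU) hpU
    (tendsto_nhdsWithin_iff.2 ⟨continuousAt_fst, continuousAt_fst.eventually (hU.mem_nhds hpU)⟩)

lemma continuousAt_partialSnd (hΩ : IsOpen Ω) (hf : ContinuousOn f Ω)
    (hsnd : ∀ p ∈ Ω, DifferentiableAt ℂ (fun v => f (p.1, v)) p.2) (hp : p ∈ Ω) :
    ContinuousAt (partialSnd f) p :=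
  ContinuousAt.comp (f := Prod.swap) (g := partialFst (f ∘ Prod.swap))
    (continuousAt_partialFst (hΩ.preimage continuous_swap)
      (hf.comp continuous_swap.continuousOn (mapsTo_preimage _ _)) (fun q hq => hsnd q.swap hq) hp)
    continuous_swap.continuousAt

lemma hasStrictFDerivAt_of_separately_differentiableAt (hΩ : IsOpen Ω) (hf : ContinuousOn f Ω)
    (hfst : ∀ p ∈ Ω, DifferentiableAt ℂ (fun z => f (z, p.2)) p.1)
    (hsnd : ∀ p ∈ Ω, DifferentiableAt ℂ (fun v => f (p.1, v)) p.2) (hp : p ∈ Ω) :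
    HasStrictFDerivAt f ((ContinuousLinearMap.toSpanSingleton ℂ (partialFst f p)).coprod
      (ContinuousLinearMap.toSpanSingleton ℂ (partialSnd f p))) p := by
  have hspan : Continuous fun a : E => ContinuousLinearMap.toSpanSingleton ℂ a :=
    (ContinuousLinearMap.toSpanSingletonCLE (𝕜 := ℂ) (E := E)).continuous
  exact hasStrictFDerivAt_uncurry_coprod (f := fun z v => f (z, v))
    (f₁ := fun z v => ContinuousLinearMap.toSpanSingleton ℂ (partialFst f (z, v)))
    (f₂ := fun z v => ContinuousLinearMap.toSpanSingleton ℂ (partialSnd f (z, v)))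
    ((hΩ.eventually_mem hp).mono fun q hq => (hfst q hq).hasDerivAt.hasFDerivAt)
    ((hΩ.eventually_mem hp).mono fun q hq => (hsnd q hq).hasDerivAt.hasFDerivAt)
    (hspan.continuousAt.comp (continuousAt_partialFst hΩ hf hfst hp))
    (hspan.continuousAt.comp (continuousAt_partialSnd hΩ hf hsnd hp))

lemma hasStrictFDerivAt_partials (hΩ : IsOpen Ω) (hf : DifferentiableOn ℂ f Ω) (hp : p ∈ Ω) :
    HasStrictFDerivAt f ((ContinuousLinearMap.toSpanSingleton ℂ (partialFst f p)).coprod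
      (ContinuousLinearMap.toSpanSingleton ℂ (partialSnd f p))) p :=
  have hdiff : ∀ p ∈ Ω, DifferentiableAt ℂ f p := fun _ hp => hf.differentiableAt (hΩ.mem_nhds hp)
  hasStrictFDerivAt_of_separately_differentiableAt hΩ hf.continuousOn
    (fun p hp => (hasDerivAt_partialFst (hdiff p hp)).differentiableAt)
    (fun p hp => (hasDerivAt_partialSnd (hdiff p hp)).differentiableAt) hp

lemma tendstoLocallyUniformlyOn_slope_snd {U V : Set ℂ} (hU : IsOpen U) (hV : IsOpen V)
    (hf : DifferentiableOn ℂ f (U ×ˢ V)) {v : ℂ} (hv : v ∈ V) :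
    TendstoLocallyUniformlyOn (fun k z => k⁻¹ • (f (z, v + k) - f (z, v)))
      (fun z => partialSnd f (z, v)) (𝓝[≠] 0) U := by
  refine hU.tendstoLocallyUniformlyOn_iff_forall_tendsto.2 fun z hz => ?_
  have hΩ := hU.prod hV
  have hzv : (z, v) ∈ U ×ˢ V := ⟨hz, hv⟩
  have hsnd : Tendsto (fun q : ℂ × ℂ => partialSnd f (q.2, v)) (𝓝[≠] 0 ×ˢ 𝓝 z)
      (𝓝 (partialSnd f (z, v))) :=
    (continuousAt_partialSnd hΩ hf.continuousOn
      (fun p hp => (hasDerivAt_partialSnd (hf.differentiableAt (hΩ.mem_nhds hp))).differentiableAt)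
      hzv).tendsto.comp (tendsto_snd.prodMk_nhds tendsto_const_nhds)
  have hincr : Tendsto (fun q : ℂ × ℂ => (((q.2, v + q.1) : ℂ × ℂ), ((q.2, v) : ℂ × ℂ)))
      (𝓝[≠] 0 ×ˢ 𝓝 z) (𝓝 ((z, v), (z, v))) := by
    have : Continuous fun q : ℂ × ℂ => (((q.2, v + q.1) : ℂ × ℂ), ((q.2, v) : ℂ × ℂ)) := by fun_prop
    simpa only [add_zero] using (this.tendsto (0, z)).mono_left
      (nhds_prod_eq (x := (0 : ℂ)) (y := z) ▸ prod_mono_left _ nhdsWithin_le_nhds)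
  have hlittle : (fun q : ℂ × ℂ => f (q.2, v + q.1) - f (q.2, v) - q.1 • partialSnd f (z, v))
      =o[𝓝[≠] 0 ×ˢ 𝓝 z] Prod.fst := by
    refine ((hasStrictFDerivAt_partials hΩ hf hzv).isLittleO.comp_tendsto hincr).congr_left
      (fun q => ?_) |>.trans_isBigO (isBigO_of_le _ fun q => ?_) <;> simp
  have hslope := hlittle.tendsto_inv_smul_nhds_zero.add_const (partialSnd f (z, v))
  rw [zero_add] at hslope
  refine ((hsnd.prodMk_nhds (hslope.congr' ?_)).mono_right (nhds_le_uniformity _))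
  filter_upwards [tendsto_fst.eventually self_mem_nhdsWithin] with q hq
  rw [smul_sub, inv_smul_smul₀ hq, sub_add_cancel]

lemma hasDerivAt_partialFst_snd (hΩ : IsOpen Ω) (hf : DifferentiableOn ℂ f Ω) (hp : p ∈ Ω) :
    HasDerivAt (fun v => partialFst f (p.1, v)) (partialFst (partialSnd f) p) p.2 := by
  obtain ⟨U, V, hU, hpU, hV, hpV, hUV⟩ := mem_nhds_prod_iff'.1 (hΩ.mem_nhds hp)
  have hslice : ∀ v ∈ V, DifferentiableOn ℂ (fun z => f (z, v)) U := fun v hv =>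
    hf.comp (by fun_prop) fun z hz => hUV ⟨hz, hv⟩
  have hnear : ∀ᶠ k in 𝓝[≠] (0 : ℂ), p.2 + k ∈ V :=
    mem_nhdsWithin_of_mem_nhds
      ((continuous_const_add p.2).continuousAt.eventually_mem (hV.mem_nhds (by simpa using hpV)))
  have hlim := (tendstoLocallyUniformlyOn_slope_snd hU hV (hf.mono hUV) hpV).deriv
    (hnear.mono fun k hk => ((hslice _ hk).sub (hslice _ hpV)).const_smul k⁻¹) hU
  rw [hasDerivAt_iff_tendsto_slope_zero]
  refine (hlim.tendsto_at hpU).congr' (hnear.mono fun k hk => ?_)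
  have hderiv : ∀ v ∈ V, HasDerivAt (fun z => f (z, v)) (partialFst f (p.1, v)) p.1 := fun v hv =>
    ((hslice v hv).differentiableAt (hU.mem_nhds hpU)).hasDerivAt
  exact (((hderiv _ hk).sub (hderiv _ hpV)).const_smul k⁻¹).deriv

lemma partialSnd_partialFst (hΩ : IsOpen Ω) (hf : DifferentiableOn ℂ f Ω) (hp : p ∈ Ω) :
    partialSnd (partialFst f) p = partialFst (partialSnd f) p :=
  (hasDerivAt_partialFst_snd hΩ hf hp).deriv

lemma differentiableOn_partialFst (hΩ : IsOpen Ω) (hf : DifferentiableOn ℂ f Ω) :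
    DifferentiableOn ℂ (partialFst f) Ω := by
  have hfst : ∀ p ∈ Ω, DifferentiableAt ℂ (fun z => f (z, p.2)) p.1 := fun p hp =>
    (hasDerivAt_partialFst (hf.differentiableAt (hΩ.mem_nhds hp))).differentiableAt
  have hfst' : ∀ p ∈ Ω, DifferentiableAt ℂ (fun z => partialFst f (z, p.2)) p.1 := fun p hp => by
    have hopen : IsOpen ((fun z => (z, p.2)) ⁻¹' Ω) := hΩ.preimage (by fun_prop)
    have hslice : DifferentiableOn ℂ (fun z => f (z, p.2)) ((fun z => (z, p.2)) ⁻¹' Ω) :=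
      fun z hz => (hfst (z, p.2) hz).differentiableWithinAt
    exact (hslice.deriv hopen).differentiableAt (hopen.mem_nhds hp)
  have hcont : ContinuousOn (partialFst f) Ω := fun p hp =>
    (continuousAt_partialFst hΩ hf.continuousOn hfst hp).continuousWithinAt
  exact fun p hp => (hasStrictFDerivAt_of_separately_differentiableAt hΩ hcont hfst'
    (fun q hq => (hasDerivAt_partialFst_snd hΩ hf hq).differentiableAt)
    hp).hasFDerivAt.differentiableAt.differentiableWithinAt

lemma differentiableOn_partialSnd (hΩ : IsOpen Ω) (hf : DifferentiableOn ℂ f Ω) :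
    DifferentiableOn ℂ (partialSnd f) Ω := by
  have hswap : Differentiable ℂ (Prod.swap : ℂ × ℂ → ℂ × ℂ) :=
    differentiable_snd.prodMk differentiable_fst
  exact (differentiableOn_partialFst (f := f ∘ Prod.swap) (hΩ.preimage continuous_swap)
    (hf.comp hswap.differentiableOn (mapsTo_preimage _ _))).comp hswap.differentiableOn
    fun _ hp => hp

lemma differentiableOn_of_separately_differentiableAt (hΩ : IsOpen Ω)
    (hfst : ∀ p ∈ Ω, DifferentiableAt ℂ (fun z => f (z, p.2)) p.1)
    (hsnd : ∀ p ∈ Ω, DifferentiableAt ℂ (fun v => f (p.1, v)) p.2)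
    (hbdd : ∀ p ∈ Ω, ∃ M, ∀ᶠ q in 𝓝 p, ‖f q‖ ≤ M) : DifferentiableOn ℂ f Ω := fun _ hp =>
  (hasStrictFDerivAt_of_separately_differentiableAt hΩ
    (continuousOn_of_separately_differentiableAt hΩ hfst hsnd hbdd) hfst hsnd
    hp).hasFDerivAt.differentiableAt.differentiableWithinAt

end TwoVariables

section Wirtinger

/-- `f` is real differentiable at `z` and `∂̄ f (z) = f'`. -/
structure HasWirtBarAt (f : ℂ → ℂ) (f' z : ℂ) : Prop where
  differentiableAt : DifferentiableAt ℝ f z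
  wirtBar_eq : wirtBar f z = f'

variable {f g : ℂ → ℂ} {f' g' z : ℂ}

lemma wirtBar_congr (h : f =ᶠ[𝓝 z] g) : wirtBar f z = wirtBar g z := by
  rw [wirtBar, wirtBar, h.fderiv_eq]

lemma wirt_congr (h : f =ᶠ[𝓝 z] g) : wirt f z = wirt g z := by
  rw [wirt, wirt, h.fderiv_eq]

lemma wirt_of_hasDerivAt (h : HasDerivAt f f' z) : wirt f z = f' := by
  rw [wirt, (h.hasFDerivAt.restrictScalars ℝ).fderiv]
  simp only [ContinuousLinearMap.coe_restrictScalars',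
    ContinuousLinearMap.toSpanSingleton_apply, smul_eq_mul]
  linear_combination -f' / 2 * Complex.I_mul_I

lemma wirt_eq_conj_wirtBar_conj (f : ℂ → ℂ) (z : ℂ) :
    wirt f z = conj (wirtBar (fun w => conj (f w)) z) := by
  have hconj : fderiv ℝ (fun w => conj (f w)) z
      = (Complex.conjCLE : ℂ →L[ℝ] ℂ).comp (fderiv ℝ f z) := Complex.conjCLE.comp_fderiv
  have htwo : conj (2 : ℂ) = 2 := Complex.conj_ofNat 2
  simp [wirt, wirtBar, hconj, sub_eq_add_neg, htwo]

namespace HasWirtBarAt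

lemma of_hasFDerivAt {L : ℂ →L[ℝ] ℂ} (h : HasFDerivAt f L z) :
    HasWirtBarAt f ((L 1 + Complex.I * L Complex.I) / 2) z :=
  ⟨h.differentiableAt, by rw [wirtBar, h.fderiv]⟩

lemma hasFDerivAt (h : HasWirtBarAt f f' z) : HasFDerivAt f (fderiv ℝ f z) z :=
  h.differentiableAt.hasFDerivAt

lemma congr_wirtBar (h : HasWirtBarAt f f' z) (h' : f' = g') : HasWirtBarAt f g' z := h' ▸ h

lemma congr_of_eventuallyEq (hf : HasWirtBarAt f f' z) (h : g =ᶠ[𝓝 z] f) : HasWirtBarAt g f' z :=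
  ⟨hf.differentiableAt.congr_of_eventuallyEq h, by rw [wirtBar_congr h, hf.wirtBar_eq]⟩

lemma add (hf : HasWirtBarAt f f' z) (hg : HasWirtBarAt g g' z) :
    HasWirtBarAt (fun w => f w + g w) (f' + g') z :=
  (of_hasFDerivAt (hf.hasFDerivAt.add hg.hasFDerivAt)).congr_wirtBar <| by
    rw [← hf.wirtBar_eq, ← hg.wirtBar_eq, wirtBar, wirtBar]
    simp only [_root_.add_apply]
    ring

lemma mul (hf : HasWirtBarAt f f' z) (hg : HasWirtBarAt g g' z) :
    HasWirtBarAt (fun w => f w * g w) (f' * g z + f z * g') z :=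
  (of_hasFDerivAt (hf.hasFDerivAt.mul hg.hasFDerivAt)).congr_wirtBar <| by
    rw [← hf.wirtBar_eq, ← hg.wirtBar_eq, wirtBar, wirtBar]
    simp only [_root_.add_apply, _root_.smul_apply, smul_eq_mul]
    ring

lemma comp {h : ℂ → ℂ} {h' : ℂ} (hh : HasDerivAt h h' (f z)) (hf : HasWirtBarAt f f' z) :
    HasWirtBarAt (fun w => h (f w)) (h' * f') z :=
  (of_hasFDerivAt (f := fun w => h (f w))
    ((hh.hasFDerivAt.restrictScalars ℝ).comp z hf.hasFDerivAt)).congr_wirtBar <| by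
    rw [← hf.wirtBar_eq, wirtBar]
    simp only [ContinuousLinearMap.comp_apply, ContinuousLinearMap.coe_restrictScalars',
      ContinuousLinearMap.toSpanSingleton_apply, smul_eq_mul]
    ring

lemma of_hasDerivAt (h : HasDerivAt f f' z) : HasWirtBarAt f 0 z :=
  (of_hasFDerivAt (h.hasFDerivAt.restrictScalars ℝ)).congr_wirtBar <| by
    simp only [ContinuousLinearMap.coe_restrictScalars',
      ContinuousLinearMap.toSpanSingleton_apply, smul_eq_mul]
    linear_combination f' / 2 * Complex.I_mul_I

lemma of_contDiffAt (hf : ContDiffAt ℝ ∞ f z) : HasWirtBarAt f (wirtBar f z) z :=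
  ⟨hf.differentiableAt (by simp), rfl⟩

lemma const (c z : ℂ) : HasWirtBarAt (fun _ => c) 0 z :=
  of_hasDerivAt (hasDerivAt_const z c)

lemma const_mul (c : ℂ) (hf : HasWirtBarAt f f' z) :
    HasWirtBarAt (fun w => c * f w) (c * f') z :=
  ((const c z).mul hf).congr_wirtBar (by ring)

lemma sub (hf : HasWirtBarAt f f' z) (hg : HasWirtBarAt g g' z) :
    HasWirtBarAt (fun w => f w - g w) (f' - g') z := by
  simpa only [neg_one_mul, sub_eq_add_neg] using hf.add (hg.const_mul (-1))

end HasWirtBarAt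

lemma HasWirtBarAt.conj (z : ℂ) : HasWirtBarAt (fun w => conj w) 1 z :=
  (HasWirtBarAt.of_hasFDerivAt Complex.conjCLE.hasFDerivAt).congr_wirtBar (by simp)

lemma wirtBar_eq_zero_of_notMem_tsupport (h : z ∉ tsupport f) : wirtBar f z = 0 :=
  ((HasWirtBarAt.const 0 z).congr_of_eventuallyEq
    (notMem_tsupport_iff_eventuallyEq.1 h)).wirtBar_eq

lemma tsupport_wirtBar_subset (f : ℂ → ℂ) : tsupport (wirtBar f) ⊆ tsupport f :=
  closure_minimal (fun _ hz => by_contra fun h => hz (wirtBar_eq_zero_of_notMem_tsupport h))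
    (isClosed_tsupport f)

lemma contDiffOn_wirtBar {U : Set ℂ} (hU : IsOpen U) (hf : ContDiffOn ℝ ∞ f U) :
    ContDiffOn ℝ ∞ (wirtBar f) U := by
  have h : ContDiffOn ℝ ∞ (fderiv ℝ f) U := hf.fderiv_of_isOpen hU (by simp)
  unfold wirtBar
  exact ((h.clm_apply contDiffOn_const).add
    (contDiffOn_const.mul (h.clm_apply contDiffOn_const))).div_const _

namespace IsTest

variable {U : Set ℂ} {φ : ℂ → ℂ}

lemma contDiffAt (hφ : IsTest U φ) (z : ℂ) : ContDiffAt ℝ ∞ φ z := hφ.smooth.contDiffAt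

lemma eq_zero_of_notMem (hφ : IsTest U φ) (hz : z ∉ U) : φ z = 0 :=
  image_eq_zero_of_notMem_tsupport fun h => hz (hφ.supp h)

lemma wirtBar (hφ : IsTest U φ) : IsTest U (wirtBar φ) where
  smooth := contDiffOn_univ.1 (contDiffOn_wirtBar isOpen_univ hφ.smooth.contDiffOn)
  compact := hφ.compact.of_isClosed_subset (isClosed_tsupport _) (tsupport_wirtBar_subset φ)
  supp := (tsupport_wirtBar_subset φ).trans hφ.supp

lemma wirtBar_iterate (hφ : IsTest U φ) (q : ℕ) : IsTest U (LocalBergman.wirtBar^[q] φ) := by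
  induction q with
  | zero => exact hφ
  | succ q ih => exact Function.iterate_succ_apply' LocalBergman.wirtBar q φ ▸ ih.wirtBar

lemma contDiffOn_mul (hφ : IsTest U φ) (hU : IsOpen U) (hf : ContDiffOn ℝ ∞ f U) :
    IsTest U fun z => f z * φ z where
  smooth := contDiff_iff_contDiffAt.2 fun z => by
    by_cases hz : z ∈ tsupport φ
    · exact (hf.contDiffAt (hU.mem_nhds (hφ.supp hz))).mul (hφ.contDiffAt z)
    · have hzero : (fun w => f w * φ w) =ᶠ[𝓝 z] fun _ => 0 := by
        filter_upwards [notMem_tsupport_iff_eventuallyEq.1 hz] with w hw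
        rw [hw, Pi.zero_apply, mul_zero]
      exact contDiffAt_const.congr_of_eventuallyEq hzero
  compact := hφ.compact.mul_left
  supp := tsupport_mul_subset_right.trans hφ.supp

end IsTest

lemma IsTest.conj {U : Set ℂ} {φ : ℂ → ℂ} (hφ : IsTest U φ) : IsTest U fun z => conj (φ z) := by
  have hsupp : tsupport (fun z => starRingEnd ℂ (φ z)) ⊆ tsupport φ :=
    tsupport_comp_subset (map_zero _) φ
  exact ⟨Complex.conjCLE.contDiff.comp hφ.smooth,
    hφ.compact.of_isClosed_subset (isClosed_tsupport _) hsupp, hsupp.trans hφ.supp⟩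

lemma hasWirtBarAt_comp_conj {F : ℂ × ℂ → ℂ} {z w : ℂ} (hF : DifferentiableAt ℂ F (z, conj w)) :
    HasWirtBarAt (fun w => F (z, conj w)) (partialSnd F (z, conj w)) w :=
  (HasWirtBarAt.comp (f := starRingEnd ℂ) (h := fun v => F (z, v)) (hasDerivAt_partialSnd hF)
    (HasWirtBarAt.conj w)).congr_wirtBar (mul_one _)

lemma hasWirtBarAt_comp_diag {F : ℂ × ℂ → ℂ} {w : ℂ} (hF : DifferentiableAt ℂ F (w, conj w)) :
    HasWirtBarAt (fun w => F (w, conj w)) (partialSnd F (w, conj w)) w := by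
  have hdiag : HasFDerivAt (fun w : ℂ => (w, conj w))
      ((ContinuousLinearMap.id ℝ ℂ).prod (Complex.conjCLE : ℂ →L[ℝ] ℂ)) w :=
    (hasFDerivAt_id w).prodMk Complex.conjCLE.hasFDerivAt
  have hcomp := (hF.hasFDerivAt.restrictScalars ℝ).comp w hdiag
  refine (HasWirtBarAt.of_hasFDerivAt (f := fun w => F (w, conj w)) hcomp).congr_wirtBar ?_
  have hsnd : partialSnd F (w, conj w) = fderiv ℂ F (w, conj w) (0, 1) :=
    (hasDerivAt_partialSnd hF).unique (hF.hasFDerivAt.comp_hasDerivAt (f := fun v => (w, v))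
      (starRingEnd ℂ w) ((hasDerivAt_const _ w).prodMk (hasDerivAt_id _)))
  have hI : Complex.I * fderiv ℂ F (w, conj w) (Complex.I, -Complex.I)
      = fderiv ℂ F (w, conj w) (-1, 1) := by
    rw [← smul_eq_mul, ← map_smul]
    simp
  simp only [ContinuousLinearMap.comp_apply, ContinuousLinearMap.coe_restrictScalars',
    ContinuousLinearMap.prod_apply, ContinuousLinearMap.id_apply, ContinuousLinearEquiv.coe_coe,
    Complex.conjCLE_apply, map_one, Complex.conj_I]
  rw [hsnd, hI, ← map_add, div_eq_iff two_ne_zero, mul_comm, ← smul_eq_mul, ← map_smul]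
  norm_num

end Wirtinger

section Polyanalytic

instance isAddHaarMeasure_areaMeasure : areaMeasure.IsAddHaarMeasure :=
  Measure.IsAddHaarMeasure.smul _ (by simp [Real.pi_pos]) ENNReal.ofReal_ne_top

variable {U : Set ℂ} {f φ : ℂ → ℂ}

lemma IsTest.integrable (hφ : IsTest U φ) : Integrable φ areaMeasure :=
  hφ.smooth.continuous.integrable_of_hasCompactSupport hφ.compact

lemma IsTest.integrable_fderiv_apply (hφ : IsTest U φ) (v : ℂ) :
    Integrable (fun z => fderiv ℝ φ z v) areaMeasure :=
  ((hφ.smooth.continuous_fderiv (by simp)).clm_apply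
    continuous_const).integrable_of_hasCompactSupport (hφ.compact.fderiv_apply ℝ v)

lemma IsTest.integral_fderiv_apply_eq_zero (hφ : IsTest U φ) (v : ℂ) :
    ∫ z, fderiv ℝ φ z v ∂areaMeasure = 0 := by
  simpa using integral_mul_fderiv_eq_neg_fderiv_mul_of_integrable (μ := areaMeasure)
    (f := fun _ : ℂ => (1 : ℂ)) (g := φ) (v := v) (by simp)
    (by simpa using hφ.integrable_fderiv_apply v) (by simpa using hφ.integrable)
    (fun _ _ => differentiableAt_const _) (fun z _ => (hφ.contDiffAt z).differentiableAt (by simp))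

lemma IsTest.integral_wirtBar_eq_zero (hφ : IsTest U φ) :
    ∫ z, LocalBergman.wirtBar φ z ∂areaMeasure = 0 := by
  unfold LocalBergman.wirtBar
  rw [integral_div, integral_add (hφ.integrable_fderiv_apply 1)
    ((hφ.integrable_fderiv_apply _).const_mul _), integral_const_mul,
    hφ.integral_fderiv_apply_eq_zero, hφ.integral_fderiv_apply_eq_zero, mul_zero, add_zero,
    zero_div]

lemma integral_mul_wirtBar (hU : IsOpen U) (hf : ContDiffOn ℝ ∞ f U) (hφ : IsTest U φ) :
    ∫ z, f z * wirtBar φ z ∂areaMeasure = -∫ z, wirtBar f z * φ z ∂areaMeasure := by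
  have hleibniz (z : ℂ) :
      wirtBar (fun w => f w * φ w) z = wirtBar f z * φ z + f z * wirtBar φ z := by
    by_cases hz : z ∈ tsupport φ
    · exact ((HasWirtBarAt.of_contDiffAt (hf.contDiffAt (hU.mem_nhds (hφ.supp hz)))).mul
        (HasWirtBarAt.of_contDiffAt (hφ.contDiffAt z))).wirtBar_eq
    · rw [wirtBar_eq_zero_of_notMem_tsupport fun h => hz (tsupport_mul_subset_right h),
        image_eq_zero_of_notMem_tsupport hz, wirtBar_eq_zero_of_notMem_tsupport hz, mul_zero,
        mul_zero, add_zero]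
  have htotal := (hφ.contDiffOn_mul hU hf).integral_wirtBar_eq_zero
  simp_rw [hleibniz] at htotal
  rw [integral_add (hφ.contDiffOn_mul hU (contDiffOn_wirtBar hU hf)).integrable
    (hφ.wirtBar.contDiffOn_mul hU hf).integrable] at htotal
  exact eq_neg_of_add_eq_zero_right htotal

lemma integral_mul_wirtBar_iterate (hU : IsOpen U) (hφ : IsTest U φ) (q : ℕ)
    (hf : ContDiffOn ℝ ∞ f U) :
    ∫ z, f z * (wirtBar^[q] φ) z ∂areaMeasure
      = (-1) ^ q * ∫ z, (wirtBar^[q] f) z * φ z ∂areaMeasure := by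
  induction q generalizing f with
  | zero => simp
  | succ q ih =>
    rw [Function.iterate_succ_apply', integral_mul_wirtBar hU hf (hφ.wirtBar_iterate q),
      ih (contDiffOn_wirtBar hU hf), Function.iterate_succ_apply, pow_succ]
    ring

lemma isPolyanalyticOn_of_wirtBar_iterate_eq_zero (hU : IsOpen U) (hf : ContDiffOn ℝ ∞ f U)
    {q : ℕ} (hq : ∀ z ∈ U, (wirtBar^[q] f) z = 0) : IsPolyanalyticOn q f U := by
  refine ⟨hf.continuousOn, fun φ hφ => ?_⟩
  have hzero (z : ℂ) : (wirtBar^[q] f) z * φ z = 0 := by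
    by_cases hz : z ∈ U
    · rw [hq z hz, zero_mul]
    · rw [hφ.eq_zero_of_notMem hz, mul_zero]
  simp [integral_mul_wirtBar_iterate hU hφ q hf, hzero]

lemma isPolyanalyticOn_two_of_eqOn (hU : IsOpen U) {A B : ℂ → ℂ} (v : ℂ)
    (hA : DifferentiableOn ℂ A U) (hB : DifferentiableOn ℂ B U)
    (hf : ∀ z ∈ U, f z = A z + (conj z - v) * B z) : IsPolyanalyticOn 2 f U := by
  have hsmooth : ContDiffOn ℝ ∞ f U := by
    have hconj : ContDiff ℝ ∞ fun z : ℂ => conj z - v := Complex.conjCLE.contDiff.sub contDiff_const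
    exact (((hA.contDiffOn hU).restrict_scalars ℝ).add
      (hconj.contDiffOn.mul ((hB.contDiffOn hU).restrict_scalars ℝ))).congr hf
  have hderiv {g : ℂ → ℂ} (hg : DifferentiableOn ℂ g U) {z : ℂ} (hz : z ∈ U) :
      HasWirtBarAt g 0 z :=
    HasWirtBarAt.of_hasDerivAt (hg.differentiableAt (hU.mem_nhds hz)).hasDerivAt
  have hwirtBar (z : ℂ) (hz : z ∈ U) : wirtBar f z = B z := by
    have hprod := ((HasWirtBarAt.conj z).sub (HasWirtBarAt.const v z)).mul (hderiv hB hz)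
    rw [wirtBar_congr (eventuallyEq_of_mem (hU.mem_nhds hz) hf),
      ((hderiv hA hz).add hprod).wirtBar_eq]
    ring
  refine isPolyanalyticOn_of_wirtBar_iterate_eq_zero hU hsmooth fun z hz => ?_
  exact (wirtBar_congr (eventuallyEq_of_mem (hU.mem_nhds hz) hwirtBar)).trans
    (hderiv hB hz).wirtBar_eq

lemma wirt_iterate_eq_conj (q : ℕ) (f : ℂ → ℂ) (z : ℂ) :
    (wirt^[q] f) z = conj ((wirtBar^[q] fun w => conj (f w)) z) := by
  induction q generalizing z with
  | zero => simp
  | succ q ih =>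
    rw [Function.iterate_succ_apply', Function.iterate_succ_apply', wirt_eq_conj_wirtBar_conj]
    simp_rw [ih, Complex.conj_conj]

lemma IsPolyanalyticOn.of_conj {q : ℕ} (h : IsPolyanalyticOn q (fun z => conj (f z)) U) :
    IsConjPolyanalyticOn q f U := by
  refine ⟨by simpa [Function.comp_def] using Complex.continuous_conj.comp_continuousOn h.1,
    fun φ hφ => ?_⟩
  have hconj := congrArg (starRingEnd ℂ) (h.2 _ hφ.conj)
  rw [← integral_conj, map_zero] at hconj
  simpa only [map_mul, Complex.conj_conj, ← wirt_iterate_eq_conj] using hconj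

end Polyanalytic

section Polarization

lemma exists_norm_le_of_re_le (c : ℂ) (M N : ℝ) {ρ R : ℝ} (hρR : ρ < R) :
    ∃ K, ∀ f : ℂ → ℂ, DifferentiableOn ℂ f (ball c R) → (∀ x ∈ ball c R, (f x).re ≤ M) →
      ‖f c‖ ≤ N → ∀ x ∈ closedBall c ρ, ‖f x‖ ≤ K := by
  refine ⟨(2 * max M 1 * R + N * (2 * R)) / (R - ρ), fun f hf hre hN x hx => ?_⟩
  have hxρ : ‖x - c‖ ≤ ρ := mem_closedBall_iff_norm.1 hx
  have hxR : ‖x - c‖ < R := hxρ.trans_lt hρR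
  have hmaps : MapsTo (fun y : ℂ => c + y) (ball 0 R) (ball c R) := fun y hy => by simpa using hy
  have hbound := Complex.borelCaratheodory (f := fun y => f (c + y)) (z := x - c)
    (lt_max_of_lt_right one_pos) (hf.comp (by fun_prop) hmaps)
    (fun y hy => (hre _ (hmaps hy)).trans (le_max_left M 1)) ((norm_nonneg _).trans_lt hxR)
    (by simpa using hxR)
  simp only [add_sub_cancel, add_zero] at hbound
  have hx₀ := norm_nonneg (x - c)
  have hN₀ := (norm_nonneg _).trans hN
  calc ‖f x‖ ≤ _ := hbound
    _ = (2 * max M 1 * ‖x - c‖ + ‖f c‖ * (R + ‖x - c‖)) / (R - ‖x - c‖) := by ring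
    _ ≤ (2 * max M 1 * R + N * (2 * R)) / (R - ρ) := by
      have hR : 0 ≤ R := hx₀.trans hxR.le
      exact div_le_div₀ (by positivity) (by gcongr; linarith) (by linarith) (by linarith)

variable {f : ℂ × ℂ → ℂ} {p : ℂ × ℂ} {r : ℝ}

lemma exists_norm_le_of_re_le_of_separately_differentiableAt {M ρ R : ℝ} (hρR : ρ < R)
    (hfst : ∀ q ∈ ball p R, DifferentiableAt ℂ (fun z => f (z, q.2)) q.1)
    (hsnd : ∀ q ∈ ball p R, DifferentiableAt ℂ (fun v => f (q.1, v)) q.2)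
    (hre : ∀ q ∈ ball p R, (f q).re ≤ M) : ∃ K, ∀ q ∈ closedBall p ρ, ‖f q‖ ≤ K := by
  obtain ⟨K₁, hK₁⟩ := exists_norm_le_of_re_le p.2 M ‖f p‖ hρR
  obtain ⟨K₂, hK₂⟩ := exists_norm_le_of_re_le p.1 M K₁ hρR
  refine ⟨K₂, fun q hq => ?_⟩
  have hmem {z v : ℂ} (hz : z ∈ ball p.1 R) (hv : v ∈ ball p.2 R) : (z, v) ∈ ball p R :=
    ball_prod_same p.1 p.2 R ▸ mk_mem_prod hz hv
  obtain ⟨hq₁, hq₂⟩ : q.1 ∈ closedBall p.1 ρ ∧ q.2 ∈ closedBall p.2 ρ := by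
    rwa [← Set.mem_prod, closedBall_prod_same]
  have hR : 0 < R := (dist_nonneg.trans hq₁).trans_lt hρR
  have hvertical : ‖f (p.1, q.2)‖ ≤ K₁ :=
    hK₁ (fun v => f (p.1, v))
      (fun v hv => (hsnd (p.1, v) (hmem (mem_ball_self hR) hv)).differentiableWithinAt)
      (fun v hv => hre _ (hmem (mem_ball_self hR) hv)) le_rfl q.2 hq₂
  have hq₂R := closedBall_subset_ball hρR hq₂
  exact hK₂ (fun z => f (z, q.2))
    (fun z hz => (hfst (z, q.2) (hmem hz hq₂R)).differentiableWithinAt)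
    (fun z hz => hre _ (hmem hz hq₂R)) hvertical q.1 hq₁

lemma differentiableOn_of_separately_differentiableAt_of_re_le
    (hfst : ∀ q ∈ ball p r, DifferentiableAt ℂ (fun z => f (z, q.2)) q.1)
    (hsnd : ∀ q ∈ ball p r, DifferentiableAt ℂ (fun v => f (q.1, v)) q.2)
    (hre : ∀ R < r, ∃ M, ∀ q ∈ ball p R, (f q).re ≤ M) : DifferentiableOn ℂ f (ball p r) := by
  refine differentiableOn_of_separately_differentiableAt isOpen_ball hfst hsnd fun q hq => ?_
  obtain ⟨ρ, hqρ, hρr⟩ := exists_between (mem_ball.1 hq)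
  obtain ⟨R, hρR, hRr⟩ := exists_between hρr
  have hsub := ball_subset_ball (x := p) hRr.le
  obtain ⟨M, hM⟩ := hre R hRr
  obtain ⟨K, hK⟩ := exists_norm_le_of_re_le_of_separately_differentiableAt hρR
    (fun q hq => hfst q (hsub hq)) (fun q hq => hsnd q (hsub hq)) hM
  exact ⟨K, eventually_of_mem (isOpen_ball.mem_nhds hqρ) fun q' hq' =>
    hK q' (ball_subset_closedBall hq')⟩

lemma mk_conj_mem_ball {z w z₀ : ℂ} :
    (z, conj w) ∈ ball (z₀, conj z₀) r ↔ z ∈ ball z₀ r ∧ w ∈ ball z₀ r := by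
  rw [← ball_prod_same, Set.mem_prod]
  simp only [mem_ball, dist_eq_norm, ← map_sub, RCLike.norm_conj]

/-- The function `(z, v) ↦ P(z, v̄)`, which is separately holomorphic when `P` is a polarization. -/
def polar (P : ℂ → ℂ → ℂ) (p : ℂ × ℂ) : ℂ := P p.1 (conj p.2)

/-- The holomorphic function of two variables with `b(z, w) = bHol P (z, w̄)`. -/
def bHol (P : ℂ → ℂ → ℂ) : ℂ × ℂ → ℂ := partialFst (partialSnd (polar P))

/-- The hypotheses on a polarization `P` of `Q` that make the two-term kernel reproducing, with
a decay rate `κ` that need not be tied to `ΔQ`. -/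
structure IsDecayingPolarization (Q : ℂ → ℝ) (P : ℂ → ℂ → ℂ) (z₀ : ℂ) (r κ : ℝ) : Prop
    extends IsPolarization Q P z₀ r where
  rate_pos : 0 < κ
  analytic : AnalyticOnNhd ℝ Q (ball z₀ r)
  bfun_ne : ∀ z ∈ ball z₀ r, ∀ w ∈ ball z₀ r, bfun P z w ≠ 0
  decay : ∀ z ∈ ball z₀ r, ∀ w ∈ ball z₀ r,
    2 * (P z w).re - Q w - Q z ≤ -κ * ‖w - z‖ ^ 2

variable {Q : ℂ → ℝ} {P : ℂ → ℂ → ℂ} {z₀ : ℂ} {κ : ℝ}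

lemma IsAdmissible.isDecayingPolarization (h : IsAdmissible Q P z₀ r) :
    IsDecayingPolarization Q P z₀ r (lapl Q z₀ / 2) where
  toIsPolarization := h.polarization
  rate_pos := by
    obtain ⟨ε, hε, hlapl⟩ := h.lapl_bound
    exact half_pos (hε.trans (hlapl z₀ (mem_ball_self h.radius_pos)))
  analytic := h.analytic
  bfun_ne := h.bfun_ne
  decay z hz w hw := (h.decay z hz w hw).trans_eq (by ring)

lemma IsPolarization.differentiableOn_polar (h : IsPolarization Q P z₀ r)
    (hre : ∀ R < r, ∃ M, ∀ z ∈ ball z₀ R, ∀ w ∈ ball z₀ R, (P z w).re ≤ M) :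
    DifferentiableOn ℂ (polar P) (ball (z₀, conj z₀) r) := by
  have hmem {R : ℝ} {q : ℂ × ℂ} (hq : q ∈ ball (z₀, conj z₀) R) :
      q.1 ∈ ball z₀ R ∧ conj q.2 ∈ ball z₀ R := by
    rwa [← mk_conj_mem_ball, Complex.conj_conj]
  refine differentiableOn_of_separately_differentiableAt_of_re_le (fun q hq => ?_)
    (fun q hq => ?_) fun R hR => ?_
  · exact (h.analytic_fst _ (hmem hq).2 _ (hmem hq).1).differentiableAt
  · have hconj := (h.antianalytic_snd _ (hmem hq).1 _ (hmem hq).2).differentiableAt.conj_conj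
    rw [Complex.conj_conj] at hconj
    exact hconj.congr_of_eventuallyEq (Eventually.of_forall fun v => (Complex.conj_conj _).symm)
  · obtain ⟨M, hM⟩ := hre R hR
    exact ⟨M, fun q hq => hM _ (hmem hq).1 _ (hmem hq).2⟩

namespace IsDecayingPolarization

lemma differentiableOn_polar (h : IsDecayingPolarization Q P z₀ r κ) :
    DifferentiableOn ℂ (polar P) (ball (z₀, conj z₀) r) := by
  refine h.toIsPolarization.differentiableOn_polar fun R hR => ?_
  have hsub : closedBall z₀ R ⊆ ball z₀ r := closedBall_subset_ball hR
  obtain ⟨M, hM⟩ := (isCompact_closedBall z₀ R).exists_bound_of_continuousOn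
    (h.analytic.continuousOn.mono hsub)
  refine ⟨M, fun z hz w hw => ?_⟩
  have hz := ball_subset_closedBall hz
  have hw := ball_subset_closedBall hw
  linarith [h.decay z (hsub hz) w (hsub hw), le_of_abs_le (hM z hz), le_of_abs_le (hM w hw),
    mul_nonneg h.rate_pos.le (sq_nonneg ‖w - z‖)]

lemma differentiableOn_bHol (h : IsDecayingPolarization Q P z₀ r κ) :
    DifferentiableOn ℂ (bHol P) (ball (z₀, conj z₀) r) :=
  differentiableOn_partialFst isOpen_ball (differentiableOn_partialSnd isOpen_ball
    h.differentiableOn_polar)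

end IsDecayingPolarization

section WirtPolar

variable {F : ℂ × ℂ → ℂ} {z w : ℂ}

lemma wirt_eq_partialFst (hF : DifferentiableOn ℂ F (ball (z₀, conj z₀) r)) {g : ℂ → ℂ}
    (hz : z ∈ ball z₀ r) (hw : w ∈ ball z₀ r) (hg : ∀ ζ ∈ ball z₀ r, g ζ = F (ζ, conj w)) :
    wirt g z = partialFst F (z, conj w) := by
  rw [wirt_congr (eventuallyEq_of_mem (isOpen_ball.mem_nhds hz) hg)]
  exact wirt_of_hasDerivAt (hasDerivAt_partialFst
    (hF.differentiableAt (isOpen_ball.mem_nhds (mk_conj_mem_ball.2 ⟨hz, hw⟩))))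

lemma wirtBar_eq_partialSnd (hF : DifferentiableOn ℂ F (ball (z₀, conj z₀) r)) {g : ℂ → ℂ}
    (hz : z ∈ ball z₀ r) (hw : w ∈ ball z₀ r) (hg : ∀ ξ ∈ ball z₀ r, g ξ = F (z, conj ξ)) :
    wirtBar g w = partialSnd F (z, conj w) := by
  rw [wirtBar_congr (eventuallyEq_of_mem (isOpen_ball.mem_nhds hw) hg)]
  exact (hasWirtBarAt_comp_conj
    (hF.differentiableAt (isOpen_ball.mem_nhds (mk_conj_mem_ball.2 ⟨hz, hw⟩)))).wirtBar_eq

lemma bfun_eq_bHol (h : DifferentiableOn ℂ (polar P) (ball (z₀, conj z₀) r))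
    (hz : z ∈ ball z₀ r) (hw : w ∈ ball z₀ r) : bfun P z w = bHol P (z, conj w) :=
  wirt_eq_partialFst (differentiableOn_partialSnd isOpen_ball h) hz hw fun ζ hζ =>
    wirtBar_eq_partialSnd h hζ hw fun ξ _ => by rw [polar, Complex.conj_conj]

end WirtPolar

namespace IsDecayingPolarization

variable {z w : ℂ}

lemma bHol_ne (h : IsDecayingPolarization Q P z₀ r κ) {q : ℂ × ℂ}
    (hq : q ∈ ball (z₀, conj z₀) r) : bHol P q ≠ 0 := by
  have hmem : q.1 ∈ ball z₀ r ∧ conj q.2 ∈ ball z₀ r := by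
    rwa [← mk_conj_mem_ball, Complex.conj_conj]
  simpa only [bfun_eq_bHol h.differentiableOn_polar hmem.1 hmem.2, Complex.conj_conj]
    using h.bfun_ne _ hmem.1 _ hmem.2

lemma wirt_bfun (h : IsDecayingPolarization Q P z₀ r κ) (hz : z ∈ ball z₀ r)
    (hw : w ∈ ball z₀ r) : wirt (fun ζ => bfun P ζ w) z = partialFst (bHol P) (z, conj w) :=
  wirt_eq_partialFst h.differentiableOn_bHol hz hw fun _ hζ =>
    bfun_eq_bHol h.differentiableOn_polar hζ hw

lemma wirtBar_bfun (h : IsDecayingPolarization Q P z₀ r κ) (hz : z ∈ ball z₀ r)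
    (hw : w ∈ ball z₀ r) : wirtBar (fun ξ => bfun P z ξ) w = partialSnd (bHol P) (z, conj w) :=
  wirtBar_eq_partialSnd h.differentiableOn_bHol hz hw fun _ hξ =>
    bfun_eq_bHol h.differentiableOn_polar hz hξ

lemma wirtBar_wirt_bfun (h : IsDecayingPolarization Q P z₀ r κ) (hz : z ∈ ball z₀ r)
    (hw : w ∈ ball z₀ r) :
    wirtBar (fun ξ => wirt (fun ζ => bfun P ζ ξ) z) w
      = partialSnd (partialFst (bHol P)) (z, conj w) :=
  wirtBar_eq_partialSnd (differentiableOn_partialFst isOpen_ball h.differentiableOn_bHol) hz hw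
    fun _ hξ => h.wirt_bfun hz hξ

end IsDecayingPolarization

end Polarization

section KernelRegularity

variable {F : ℂ × ℂ → ℂ} {Q : ℂ → ℝ} {P : ℂ → ℂ → ℂ} {z₀ z w : ℂ} {r κ : ℝ}

lemma differentiableOn_slice_fst (hF : DifferentiableOn ℂ F (ball (z₀, conj z₀) r))
    (hw : w ∈ ball z₀ r) : DifferentiableOn ℂ (fun z => F (z, conj w)) (ball z₀ r) :=
  hF.comp (by fun_prop) fun _ hz => mk_conj_mem_ball.2 ⟨hz, hw⟩

lemma analyticOnNhd_comp_mk_conj (hF : DifferentiableOn ℂ F (ball (z₀, conj z₀) r))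
    (hz : z ∈ ball z₀ r) : AnalyticOnNhd ℝ (fun w => F (z, conj w)) (ball z₀ r) := by
  intro w hw
  have hmk : Differentiable ℂ fun v : ℂ => (z, v) := by fun_prop
  have hslice : DifferentiableOn ℂ (fun v => F (z, v)) ((fun v => (z, v)) ⁻¹' ball _ r) :=
    hF.comp hmk.differentiableOn (mapsTo_preimage _ _)
  have hanalytic : AnalyticAt ℂ (fun v => F (z, v)) (conj w) :=
    hslice.analyticAt ((isOpen_ball.preimage hmk.continuous).mem_nhds (mk_conj_mem_ball.2 ⟨hz, hw⟩))
  exact hanalytic.restrictScalars.comp (g := fun v => F (z, v)) (f := starRingEnd ℂ)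
    ((Complex.conjCLE : ℂ →L[ℝ] ℂ).analyticAt w)

lemma differentiableOn_conj_slice_snd (hF : DifferentiableOn ℂ F (ball (z₀, conj z₀) r))
    (hz : z ∈ ball z₀ r) : DifferentiableOn ℂ (fun w => conj (F (z, conj w))) (ball z₀ r) := by
  intro w hw
  have hdiff : DifferentiableAt ℂ (fun v => F (z, v)) (conj w) :=
    (hF.differentiableAt (isOpen_ball.mem_nhds (mk_conj_mem_ball.2 ⟨hz, hw⟩))).comp (conj w)
      (by fun_prop)
  have hconj := hdiff.conj_conj
  rw [Complex.conj_conj] at hconj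
  exact hconj.differentiableWithinAt

/-- The coefficient of `m |z - w|² e^{mP}` in the two-term kernel, as a holomorphic function of
`(z, w̄)`. -/
def mixedCoeff (P : ℂ → ℂ → ℂ) (p : ℂ × ℂ) : ℂ :=
  -(3 / 2) * partialSnd (partialFst (bHol P)) p
    + partialFst (bHol P) p * partialSnd (bHol P) p / bHol P p

lemma norm_sub_sq_eq (z w : ℂ) : (‖z - w‖ : ℂ) ^ 2 = (z - w) * (conj z - conj w) := by
  rw [← map_sub, Complex.mul_conj, Complex.normSq_eq_norm_sq]
  push_cast
  rfl

namespace IsDecayingPolarization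

lemma coeff0_eq (h : IsDecayingPolarization Q P z₀ r κ) (hz : z ∈ ball z₀ r)
    (hw : w ∈ ball z₀ r) :
    coeff0 P z w = -((z - w) * (conj z - conj w)) * bHol P (z, conj w) ^ 2 := by
  rw [coeff0, bfun_eq_bHol h.differentiableOn_polar hz hw, norm_sub_sq_eq]

lemma coeff1_eq (h : IsDecayingPolarization Q P z₀ r κ) (hz : z ∈ ball z₀ r)
    (hw : w ∈ ball z₀ r) :
    coeff1 P z w
      = 2 * bHol P (z, conj w) + (z - w) * partialFst (bHol P) (z, conj w)
        - (conj z - conj w) * partialSnd (bHol P) (z, conj w)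
        + (z - w) * (conj z - conj w) * mixedCoeff P (z, conj w) := by
  rw [coeff1, h.wirtBar_wirt_bfun hz hw, h.wirtBar_bfun hz hw, h.wirt_bfun hz hw,
    bfun_eq_bHol h.differentiableOn_polar hz hw, norm_sub_sq_eq, mixedCoeff]

lemma twoTermKernel_eq (h : IsDecayingPolarization Q P z₀ r κ) (m : ℝ) (hz : z ∈ ball z₀ r)
    (hw : w ∈ ball z₀ r) :
    twoTermKernel P m z w
      = (m * (2 * bHol P (z, conj w) + (z - w) * partialFst (bHol P) (z, conj w)
            - (conj z - conj w) * partialSnd (bHol P) (z, conj w))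
          + (z - w) * (conj z - conj w)
            * (m * mixedCoeff P (z, conj w) - m ^ 2 * bHol P (z, conj w) ^ 2))
        * Complex.exp (m * polar P (z, conj w)) := by
  rw [twoTermKernel, h.coeff0_eq hz hw, h.coeff1_eq hz hw, polar, Complex.conj_conj]
  ring

lemma differentiableOn_mixedCoeff (h : IsDecayingPolarization Q P z₀ r κ) :
    DifferentiableOn ℂ (mixedCoeff P) (ball (z₀, conj z₀) r) := by
  have hb := h.differentiableOn_bHol
  have hb₁ := differentiableOn_partialFst isOpen_ball hb
  have hb₂ := differentiableOn_partialSnd isOpen_ball hb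
  have hb₁₂ := differentiableOn_partialSnd isOpen_ball hb₁
  have hinv : DifferentiableOn ℂ (fun p => (bHol P p)⁻¹) (ball (z₀, conj z₀) r) :=
    hb.inv fun _ => h.bHol_ne
  unfold mixedCoeff
  simp only [div_eq_mul_inv]
  fun_prop

lemma polyanalytic_fst (h : IsDecayingPolarization Q P z₀ r κ) (m : ℝ) (hw : w ∈ ball z₀ r) :
    IsPolyanalyticOn 2 (fun z => twoTermKernel P m z w) (ball z₀ r) := by
  have hP := h.differentiableOn_polar
  have hb := h.differentiableOn_bHol
  have hb₁ := differentiableOn_partialFst isOpen_ball hb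
  have hb₂ := differentiableOn_partialSnd isOpen_ball hb
  have hk := h.differentiableOn_mixedCoeff
  have hA : DifferentiableOn ℂ (fun p => m * (2 * bHol P p + (p.1 - w) * partialFst (bHol P) p)
      * Complex.exp (m * polar P p)) (ball (z₀, conj z₀) r) := by fun_prop
  have hB : DifferentiableOn ℂ (fun p => (-m * partialSnd (bHol P) p
      + (p.1 - w) * (m * mixedCoeff P p - m ^ 2 * bHol P p ^ 2)) * Complex.exp (m * polar P p))
      (ball (z₀, conj z₀) r) := by fun_prop
  refine isPolyanalyticOn_two_of_eqOn isOpen_ball (conj w) (differentiableOn_slice_fst hA hw)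
    (differentiableOn_slice_fst hB hw) fun z hz => ?_
  rw [h.twoTermKernel_eq m hz hw]
  ring

lemma exists_twoTermKernel_eq_add_mul (h : IsDecayingPolarization Q P z₀ r κ) (m : ℝ)
    (hz : z ∈ ball z₀ r) :
    ∃ A B : ℂ × ℂ → ℂ, DifferentiableOn ℂ A (ball (z₀, conj z₀) r) ∧
      DifferentiableOn ℂ B (ball (z₀, conj z₀) r) ∧
      ∀ w ∈ ball z₀ r, twoTermKernel P m z w = A (z, conj w) + (w - z) * B (z, conj w) := by
  have hP := h.differentiableOn_polar
  have hb := h.differentiableOn_bHol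
  have hb₁ := differentiableOn_partialFst isOpen_ball hb
  have hb₂ := differentiableOn_partialSnd isOpen_ball hb
  have hk := h.differentiableOn_mixedCoeff
  refine ⟨fun p => m * (2 * bHol P p - (conj z - p.2) * partialSnd (bHol P) p)
      * Complex.exp (m * polar P p),
    fun p => -(m * partialFst (bHol P) p
        + (conj z - p.2) * (m * mixedCoeff P p - m ^ 2 * bHol P p ^ 2))
      * Complex.exp (m * polar P p),
    by fun_prop, by fun_prop, fun w hw => ?_⟩
  rw [h.twoTermKernel_eq m hz hw]
  ring

lemma conjPolyanalytic_snd (h : IsDecayingPolarization Q P z₀ r κ) (m : ℝ)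
    (hz : z ∈ ball z₀ r) :
    IsConjPolyanalyticOn 2 (fun w => twoTermKernel P m z w) (ball z₀ r) := by
  obtain ⟨A, B, hA, hB, hAB⟩ := h.exists_twoTermKernel_eq_add_mul m hz
  refine (isPolyanalyticOn_two_of_eqOn isOpen_ball (conj z) (differentiableOn_conj_slice_snd hA hz)
    (differentiableOn_conj_slice_snd hB hz) fun w hw => ?_).of_conj
  rw [hAB w hw, map_add, map_mul, map_sub]

lemma analytic_snd (h : IsDecayingPolarization Q P z₀ r κ) (m : ℝ) (hz : z ∈ ball z₀ r) :
    AnalyticOnNhd ℝ (fun w => twoTermKernel P m z w) (ball z₀ r) := by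
  obtain ⟨A, B, hA, hB, hAB⟩ := h.exists_twoTermKernel_eq_add_mul m hz
  intro w hw
  have hsub : AnalyticAt ℝ (fun w => w - z) w := analyticAt_id.sub analyticAt_const
  refine ((analyticOnNhd_comp_mk_conj hA hz w hw).fun_add
    (hsub.fun_mul (analyticOnNhd_comp_mk_conj hB hz w hw))).congr ?_
  filter_upwards [isOpen_ball.mem_nhds hw] with ξ hξ
  exact (hAB ξ hξ).symm

end IsDecayingPolarization

end KernelRegularity

section FundamentalSolution

/-- The denominator `1 + c² |ζ|²` of the regularized fundamental solution `regSol`. -/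
def regDen (c : ℝ) (ζ : ℂ) : ℂ := 1 + (c : ℂ) ^ 2 * (ζ * conj ζ)

/-- A smooth regularization of the fundamental solution `conj ζ / ζ` of `∂̄²`, which it approaches
as `c → ∞`. -/
def regSol (c : ℝ) (ζ : ℂ) : ℂ := (c : ℂ) ^ 2 * (conj ζ * conj ζ) * (regDen c ζ)⁻¹

/-- The `∂̄`-derivative of `regSol`, a regularization of the Cauchy kernel `1 / ζ`. -/
def regSol₁ (c : ℝ) (ζ : ℂ) : ℂ :=
  (c : ℂ) ^ 2 * (conj ζ * (regDen c ζ + 1)) * ((regDen c ζ)⁻¹ * (regDen c ζ)⁻¹)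

variable (c : ℝ) (ζ : ℂ)

lemma regDen_eq : regDen c ζ = ((1 + c ^ 2 * ‖ζ‖ ^ 2 : ℝ) : ℂ) := by
  rw [regDen, Complex.mul_conj']
  push_cast
  rfl

lemma regDen_ne_zero : regDen c ζ ≠ 0 := by
  rw [regDen_eq, Complex.ofReal_ne_zero]
  positivity

lemma contDiff_regDen : ContDiff ℝ ∞ (regDen c) :=
  contDiff_const.add (contDiff_const.mul (contDiff_id.mul Complex.conjCLE.contDiff))

lemma contDiff_regSol : ContDiff ℝ ∞ (regSol c) :=
  (contDiff_const.mul (Complex.conjCLE.contDiff.mul Complex.conjCLE.contDiff)).mul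
    ((contDiff_regDen c).inv (regDen_ne_zero c))

lemma contDiff_regSol₁ : ContDiff ℝ ∞ (regSol₁ c) :=
  (contDiff_const.mul (Complex.conjCLE.contDiff.mul ((contDiff_regDen c).add contDiff_const))).mul
    (((contDiff_regDen c).inv (regDen_ne_zero c)).mul ((contDiff_regDen c).inv (regDen_ne_zero c)))

lemma hasWirtBarAt_regDen : HasWirtBarAt (regDen c) ((c : ℂ) ^ 2 * ζ) ζ :=
  ((HasWirtBarAt.const 1 ζ).add (((HasWirtBarAt.of_hasDerivAt (hasDerivAt_id ζ)).mul
    (HasWirtBarAt.conj ζ)).const_mul ((c : ℂ) ^ 2))).congr_wirtBar (by simp)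

lemma hasWirtBarAt_regDen_inv :
    HasWirtBarAt (fun ζ => (regDen c ζ)⁻¹) (-(regDen c ζ ^ 2)⁻¹ * ((c : ℂ) ^ 2 * ζ)) ζ :=
  HasWirtBarAt.comp (h := fun x => x⁻¹) (hasDerivAt_inv (regDen_ne_zero c ζ))
    (hasWirtBarAt_regDen c ζ)

lemma hasWirtBarAt_regSol : HasWirtBarAt (regSol c) (regSol₁ c ζ) ζ := by
  refine ((((HasWirtBarAt.conj ζ).mul (HasWirtBarAt.conj ζ)).const_mul ((c : ℂ) ^ 2)).mul
    (hasWirtBarAt_regDen_inv c ζ)).congr_wirtBar ?_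
  have := regDen_ne_zero c ζ
  rw [regSol₁]
  field_simp
  rw [regDen]
  ring

lemma hasWirtBarAt_regSol₁ : HasWirtBarAt (regSol₁ c) (2 * (c : ℂ) ^ 2 / regDen c ζ ^ 3) ζ := by
  have hi := hasWirtBarAt_regDen_inv c ζ
  refine ((((HasWirtBarAt.conj ζ).mul ((hasWirtBarAt_regDen c ζ).add
    (HasWirtBarAt.const 1 ζ))).const_mul ((c : ℂ) ^ 2)).mul (hi.mul hi)).congr_wirtBar ?_
  have := regDen_ne_zero c ζ
  field_simp
  rw [regDen]
  ring

-- Division by zero gives `0` on both sides at `ζ = 0`; likewise in `regSol₁_eq`.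
lemma regSol_eq : regSol c ζ = (1 - (regDen c ζ)⁻¹ ^ 1) * (conj ζ / ζ) := by
  rcases eq_or_ne ζ 0 with rfl | hζ
  · simp [regSol]
  · have := regDen_ne_zero c ζ
    rw [regSol]
    field_simp
    rw [regDen]
    ring

lemma regSol₁_eq : regSol₁ c ζ = (1 - (regDen c ζ)⁻¹ ^ 2) * ζ⁻¹ := by
  rcases eq_or_ne ζ 0 with rfl | hζ
  · simp [regSol₁]
  · have := regDen_ne_zero c ζ
    rw [regSol₁]
    field_simp
    rw [regDen]
    ring

lemma norm_one_sub_inv_regDen_pow_le (n : ℕ) : ‖1 - (regDen c ζ)⁻¹ ^ n‖ ≤ 1 := by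
  set s : ℝ := (1 + c ^ 2 * ‖ζ‖ ^ 2)⁻¹
  have hs₀ : 0 ≤ s := by positivity
  have hs₁ : s ≤ 1 := inv_le_one_of_one_le₀ (le_add_of_nonneg_right (by positivity))
  have h : 1 - (regDen c ζ)⁻¹ ^ n = ((1 - s ^ n : ℝ) : ℂ) := by
    rw [regDen_eq]
    push_cast [s]
    rfl
  rw [h, Complex.norm_real, Real.norm_of_nonneg (sub_nonneg.2 (pow_le_one₀ hs₀ hs₁))]
  exact sub_le_self 1 (pow_nonneg hs₀ n)

lemma norm_regSol_le : ‖regSol c ζ‖ ≤ 1 := by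
  rw [regSol_eq, norm_mul]
  refine mul_le_one₀ (norm_one_sub_inv_regDen_pow_le c ζ 1) (norm_nonneg _) ?_
  rw [norm_div, RCLike.norm_conj]
  exact div_self_le_one _

lemma norm_regSol₁_le : ‖regSol₁ c ζ‖ ≤ ‖ζ‖⁻¹ := by
  rw [regSol₁_eq, norm_mul, norm_inv]
  exact mul_le_of_le_one_left (by positivity) (norm_one_sub_inv_regDen_pow_le c ζ 2)

variable {ζ}

lemma tendsto_inv_regDen (hζ : ζ ≠ 0) : Tendsto (fun c => (regDen c ζ)⁻¹) atTop (𝓝 0) := by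
  have h : Tendsto (fun c : ℝ => 1 + c ^ 2 * ‖ζ‖ ^ 2) atTop atTop :=
    tendsto_atTop_add_const_left _ _ ((tendsto_pow_atTop two_ne_zero).atTop_mul_const
      (by positivity))
  refine ((Complex.continuous_ofReal.tendsto 0).comp
    (tendsto_inv_atTop_zero.comp h)).congr fun c => ?_
  simp [regDen_eq]

lemma tendsto_one_sub_inv_regDen_pow (hζ : ζ ≠ 0) {n : ℕ} (hn : n ≠ 0) :
    Tendsto (fun c => 1 - (regDen c ζ)⁻¹ ^ n) atTop (𝓝 1) := by
  simpa [hn] using ((tendsto_inv_regDen hζ).pow n).const_sub 1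

lemma tendsto_regSol (hζ : ζ ≠ 0) : Tendsto (fun c => regSol c ζ) atTop (𝓝 (conj ζ / ζ)) := by
  simpa [regSol_eq] using (tendsto_one_sub_inv_regDen_pow hζ one_ne_zero).mul_const (conj ζ / ζ)

lemma tendsto_regSol₁ (hζ : ζ ≠ 0) : Tendsto (fun c => regSol₁ c ζ) atTop (𝓝 ζ⁻¹) := by
  simpa only [regSol₁_eq, one_mul] using
    (tendsto_one_sub_inv_regDen_pow hζ two_ne_zero).mul_const ζ⁻¹

end FundamentalSolution

section ApproximateIdentity

lemma areaMeasure_real_ball : areaMeasure.real (ball (0 : ℂ) 1) = 1 := by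
  rw [areaMeasure, measureReal_def, Measure.smul_apply, Complex.volume_ball]
  simp [Real.pi_pos.le, Real.pi_ne_zero]

lemma integral_Ioi_mul_peak : ∫ x in Ioi (0 : ℝ), x * (2 / (1 + x ^ 2) ^ 3) = 1 / 2 := by
  have hderiv (x : ℝ) : HasDerivAt (fun t : ℝ => -(1 / 2) * ((1 + t ^ 2) ^ 2)⁻¹)
      (x * (2 / (1 + x ^ 2) ^ 3)) x := by
    have hx : 1 + x ^ 2 ≠ 0 := by positivity
    refine (((((hasDerivAt_pow 2 x).const_add 1).fun_pow 2).fun_inv (by positivity)).const_mul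
      (-(1 / 2) : ℝ)).congr_deriv ?_
    push_cast
    field_simp
  have hlim : Tendsto (fun t : ℝ => -(1 / 2) * ((1 + t ^ 2) ^ 2)⁻¹) atTop (𝓝 (-(1 / 2) * 0)) :=
    (tendsto_inv_atTop_zero.comp ((tendsto_pow_atTop two_ne_zero).comp
      (tendsto_atTop_add_const_left _ _ (tendsto_pow_atTop two_ne_zero)))).const_mul _
  rw [integral_Ioi_of_hasDerivAt_of_nonneg' (fun x _ => hderiv x)
    (fun x (hx : 0 < x) => by positivity) hlim]
  norm_num

lemma integral_peak : ∫ ζ : ℂ, 2 / (1 + ‖ζ‖ ^ 2) ^ 3 ∂areaMeasure = 1 := by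
  rw [integral_fun_norm_addHaar areaMeasure fun t : ℝ => 2 / (1 + t ^ 2) ^ 3,
    areaMeasure_real_ball, Complex.finrank_real_complex]
  simp only [smul_eq_mul, Nat.add_one_sub_one, pow_one, integral_Ioi_mul_peak]
  norm_num

lemma tendsto_norm_pow_mul_peak :
    Tendsto (fun ζ : ℂ => ‖ζ‖ ^ Module.finrank ℝ ℂ * (2 / (1 + ‖ζ‖ ^ 2) ^ 3))
      (Bornology.cobounded ℂ) (𝓝 0) := by
  have hlim : Tendsto (fun t : ℝ => 2 * (1 + t ^ 2)⁻¹) atTop (𝓝 (2 * 0)) :=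
    (tendsto_inv_atTop_zero.comp
      (tendsto_atTop_add_const_left _ _ (tendsto_pow_atTop two_ne_zero))).const_mul 2
  rw [mul_zero] at hlim
  refine squeeze_zero (fun ζ => by positivity) (fun ζ => ?_)
    (hlim.comp tendsto_norm_cobounded_atTop)
  have ht : 0 ≤ ‖ζ‖ ^ 2 := by positivity
  rw [Complex.finrank_real_complex, Function.comp_apply, mul_div_assoc', ← div_eq_mul_inv,
    div_le_div_iff₀ (by positivity) (by positivity)]
  nlinarith [pow_nonneg ht 2, pow_nonneg ht 3]

lemma tendsto_integral_mul_peak {f : ℂ → ℂ} {z : ℂ} (hf : Integrable f areaMeasure)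
    (hz : ContinuousAt f z) :
    Tendsto (fun c : ℝ => ∫ w, f w * (2 * (c : ℂ) ^ 2 / regDen c (w - z) ^ 3) ∂areaMeasure) atTop
      (𝓝 (f z)) := by
  refine (tendsto_integral_comp_smul_smul_of_integrable' (fun x => by positivity) integral_peak
    tendsto_norm_pow_mul_peak hf hz).congr fun c => integral_congr_ae (.of_forall fun w => ?_)
  have hnorm : ‖c • (z - w)‖ ^ 2 = c ^ 2 * ‖w - z‖ ^ 2 := by
    rw [norm_smul, norm_sub_rev, mul_pow, Real.norm_eq_abs, sq_abs]
  simp only [regDen_eq, Complex.finrank_real_complex, hnorm]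
  rw [Complex.real_smul]
  push_cast
  ring

end ApproximateIdentity

section Representation

lemma HasWirtBarAt.comp_sub_const {f : ℂ → ℂ} {f' z w : ℂ} (h : HasWirtBarAt f f' (w - z)) :
    HasWirtBarAt (fun w => f (w - z)) f' w :=
  (HasWirtBarAt.of_hasFDerivAt ((hasFDerivAt_comp_sub z).2 h.hasFDerivAt)).congr_wirtBar
    h.wirtBar_eq

lemma locallyIntegrable_norm_inv : LocallyIntegrable (fun ζ : ℂ => ‖ζ‖⁻¹) areaMeasure :=
  locallyIntegrable_of_norm_le_rpow (C := 1) (α := 1) (by simp [Complex.finrank_real_complex])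
    (by simp [Complex.finrank_real_complex]) (.of_forall fun ζ => by simp [Real.rpow_neg_one])
    measurable_norm.inv.aestronglyMeasurable

lemma integrable_norm_mul_norm_sub_inv {f : ℂ → ℂ} (hf : Continuous f) (hfc : HasCompactSupport f)
    (z : ℂ) : Integrable (fun w => ‖f w‖ * ‖w - z‖⁻¹) areaMeasure := by
  have hc : HasCompactSupport fun ζ => ‖f (ζ + z)‖ :=
    (hfc.comp_homeomorph (Homeomorph.addRight z)).norm
  have h : Integrable (fun ζ => ‖f (ζ + z)‖ * ‖ζ‖⁻¹) areaMeasure :=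
    locallyIntegrable_norm_inv.integrable_smul_left_of_hasCompactSupport
      (hf.comp (continuous_add_const z)).norm hc
  simpa using h.comp_sub_right z

variable {u G : ℂ → ℂ}

lemma wirtBar_wirtBar_mul_regSol (hG : IsTest univ G) (c : ℝ) (z w : ℂ) :
    wirtBar (wirtBar fun w => G w * regSol c (w - z)) w
      = G w * (2 * (c : ℂ) ^ 2 / regDen c (w - z) ^ 3)
        + (2 * wirtBar G w * regSol₁ c (w - z) + wirtBar (wirtBar G) w * regSol c (w - z)) := by
  have hS (w : ℂ) := (hasWirtBarAt_regSol c (w - z)).comp_sub_const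
  have hS₁ := (hasWirtBarAt_regSol₁ c (w - z)).comp_sub_const
  have hG₀ (w : ℂ) := HasWirtBarAt.of_contDiffAt (hG.contDiffAt w)
  have hG₁ := HasWirtBarAt.of_contDiffAt (hG.wirtBar.contDiffAt w)
  rw [funext fun w => ((hG₀ w).mul (hS w)).wirtBar_eq,
    ((hG₁.mul (hS w)).add ((hG₀ w).mul hS₁)).wirtBar_eq]
  ring

lemma IsPolyanalyticOn.integral_peak_add_integral_regSol (hu : IsPolyanalyticOn 2 u univ)
    (hG : IsTest univ G) (c : ℝ) (z : ℂ) :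
    ∫ w, u w * G w * (2 * (c : ℂ) ^ 2 / regDen c (w - z) ^ 3) ∂areaMeasure
      + ∫ w, u w * (2 * wirtBar G w * regSol₁ c (w - z)
        + wirtBar (wirtBar G) w * regSol c (w - z)) ∂areaMeasure = 0 := by
  have huc : Continuous u := continuousOn_univ.1 hu.1
  have hS : ContDiff ℝ ∞ fun w => regSol c (w - z) :=
    (contDiff_regSol c).comp (contDiff_id.sub contDiff_const)
  have hS₁ : Continuous fun w => regSol₁ c (w - z) :=
    (contDiff_regSol₁ c).continuous.comp (continuous_sub_right z)
  have hD : Continuous fun w => regDen c (w - z) :=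
    (contDiff_regDen c).continuous.comp (continuous_sub_right z)
  have htest : IsTest univ fun w => G w * regSol c (w - z) :=
    ⟨hG.smooth.mul hS, hG.compact.mul_right, subset_univ _⟩
  have h : ∫ w, u w * wirtBar (wirtBar fun w => G w * regSol c (w - z)) w ∂areaMeasure = 0 :=
    hu.2 _ htest
  simp_rw [wirtBar_wirtBar_mul_regSol hG, mul_add (u _) (G _ * _), ← mul_assoc (u _) (G _)] at h
  rw [← h, integral_add]
  · exact ((huc.mul hG.smooth.continuous).mul (continuous_const.div (hD.pow 3)
      fun w => pow_ne_zero 3 (regDen_ne_zero c _))).integrable_of_hasCompactSupport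
      hG.compact.mul_left.mul_right
  · refine (huc.mul (((continuous_const.mul hG.wirtBar.smooth.continuous).mul hS₁).add
      (hG.wirtBar.wirtBar.smooth.continuous.mul hS.continuous))).integrable_of_hasCompactSupport ?_
    exact (hG.wirtBar.compact.mul_left.mul_right.add hG.wirtBar.wirtBar.compact.mul_right).mul_left

/-- The integrand of the Cauchy-Pompeiu formula for `∂̄²`, for the product `u G`. -/
def pompeiuIntegrand (u G : ℂ → ℂ) (z w : ℂ) : ℂ :=
  u w * (2 * wirtBar G w * (w - z)⁻¹ + wirtBar (wirtBar G) w * (conj (w - z) / (w - z)))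

/-- An integrable bound of `pompeiuIntegrand` and of its regularizations. -/
def pompeiuBound (u G : ℂ → ℂ) (z w : ℂ) : ℝ :=
  2 * (‖u w * wirtBar G w‖ * ‖w - z‖⁻¹) + ‖u w * wirtBar (wirtBar G) w‖

lemma integrable_pompeiuBound (hu : Continuous u) (hG : IsTest univ G) (z : ℂ) :
    Integrable (pompeiuBound u G z) areaMeasure :=
  ((integrable_norm_mul_norm_sub_inv (hu.mul hG.wirtBar.smooth.continuous)
    hG.wirtBar.compact.mul_left z).const_mul 2).add
    ((hu.mul hG.wirtBar.wirtBar.smooth.continuous).integrable_of_hasCompactSupport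
      hG.wirtBar.wirtBar.compact.mul_left).norm

lemma norm_mul_add_le_pompeiuBound {z w S₁ S : ℂ} (hS₁ : ‖S₁‖ ≤ ‖w - z‖⁻¹) (hS : ‖S‖ ≤ 1) :
    ‖u w * (2 * wirtBar G w * S₁ + wirtBar (wirtBar G) w * S)‖ ≤ pompeiuBound u G z w := by
  calc ‖u w * (2 * wirtBar G w * S₁ + wirtBar (wirtBar G) w * S)‖
      = ‖2 * (u w * wirtBar G w * S₁) + u w * wirtBar (wirtBar G) w * S‖ := by ring_nf
    _ ≤ 2 * (‖u w * wirtBar G w‖ * ‖S₁‖) + ‖u w * wirtBar (wirtBar G) w‖ * ‖S‖ := by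
      refine (norm_add_le _ _).trans_eq ?_
      rw [norm_mul 2, Complex.norm_ofNat, norm_mul _ S₁, norm_mul _ S]
    _ ≤ pompeiuBound u G z w := by
      rw [pompeiuBound]
      gcongr
      exact mul_le_of_le_one_right (norm_nonneg _) hS

lemma integrable_pompeiuIntegrand (hu : Continuous u) (hG : IsTest univ G) (z : ℂ) :
    Integrable (pompeiuIntegrand u G z) areaMeasure := by
  refine (integrable_pompeiuBound hu hG z).mono' ?_ (.of_forall fun w =>
    norm_mul_add_le_pompeiuBound (norm_inv _).le ?_)
  · have := hu.measurable
    have := hG.wirtBar.smooth.continuous.measurable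
    have := hG.wirtBar.wirtBar.smooth.continuous.measurable
    have := Complex.continuous_conj.measurable
    unfold pompeiuIntegrand
    fun_prop
  · rw [norm_div, RCLike.norm_conj]
    exact div_self_le_one _

lemma tendsto_integral_regSol (hu : Continuous u) (hG : IsTest univ G) (z : ℂ) :
    Tendsto (fun c => ∫ w, u w * (2 * wirtBar G w * regSol₁ c (w - z)
        + wirtBar (wirtBar G) w * regSol c (w - z)) ∂areaMeasure) atTop
      (𝓝 (∫ w, pompeiuIntegrand u G z w ∂areaMeasure)) := by
  have hG₁ := hG.wirtBar.smooth.continuous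
  have hG₂ := hG.wirtBar.wirtBar.smooth.continuous
  refine tendsto_integral_filter_of_dominated_convergence (pompeiuBound u G z)
    (.of_forall fun c => Continuous.aestronglyMeasurable ?_)
    (.of_forall fun c => .of_forall fun w =>
      norm_mul_add_le_pompeiuBound (norm_regSol₁_le c _) (norm_regSol_le c _))
    (integrable_pompeiuBound hu hG z) ?_
  · have := (contDiff_regSol c).continuous
    have := (contDiff_regSol₁ c).continuous
    fun_prop
  · filter_upwards [(countable_singleton z).ae_notMem areaMeasure] with w hw
    have hwz : w - z ≠ 0 := sub_ne_zero.2 hw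
    exact (((tendsto_regSol₁ hwz).const_mul _).add ((tendsto_regSol hwz).const_mul _)).const_mul _

theorem IsPolyanalyticOn.mul_eq_neg_integral_pompeiuIntegrand (hu : IsPolyanalyticOn 2 u univ)
    (hG : IsTest univ G) (z : ℂ) :
    u z * G z = -∫ w, pompeiuIntegrand u G z w ∂areaMeasure := by
  have huc : Continuous u := continuousOn_univ.1 hu.1
  have huG : Continuous fun w => u w * G w := huc.mul hG.smooth.continuous
  have hpeak := tendsto_integral_mul_peak
    (huG.integrable_of_hasCompactSupport hG.compact.mul_left) (huG.continuousAt (x := z))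
  refine eq_neg_of_add_eq_zero_left (tendsto_nhds_unique
    (hpeak.add (tendsto_integral_regSol huc hG z)) ?_)
  simp only [hu.integral_peak_add_integral_regSol hG, tendsto_const_nhds]

end Representation

section TaylorEstimates

lemma norm_sub_taylor_sum_le {𝕜 E : Type*} [RCLike 𝕜] [NormedAddCommGroup E] [NormedSpace 𝕜 E]
    {s : Set 𝕜} (hs : Convex ℝ s) {z w : 𝕜} (hz : z ∈ s) (hw : w ∈ s) {M : ℝ} {n : ℕ}
    {f : ℕ → 𝕜 → E} (hf : ∀ k < n, ∀ x ∈ s, HasDerivWithinAt (f k) (f (k + 1) x) s x)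
    (hM : ∀ x ∈ s, ‖f n x‖ ≤ M) :
    ‖f 0 w - ∑ k ∈ Finset.range n, ((k.factorial : 𝕜)⁻¹ * (w - z) ^ k) • f k z‖
      ≤ M * ‖w - z‖ ^ n := by
  induction n generalizing f w with
  | zero => simpa using hM w hw
  | succ n ih =>
    set t : Set 𝕜 := s ∩ closedBall z ‖w - z‖
    have hwt : w ∈ t := ⟨hw, mem_closedBall_iff_norm.2 le_rfl⟩
    have hzt : z ∈ t := ⟨hz, mem_closedBall_self (norm_nonneg _)⟩
    have hM₀ : 0 ≤ M := (norm_nonneg _).trans (hM z hz)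
    have hderiv (x : 𝕜) (hx : x ∈ t) : HasDerivWithinAt
        (fun x => f 0 x - ∑ k ∈ Finset.range (n + 1), ((k.factorial : 𝕜)⁻¹ * (x - z) ^ k) • f k z)
        (f 1 x - ∑ k ∈ Finset.range n, ((k.factorial : 𝕜)⁻¹ * (x - z) ^ k) • f (k + 1) z) t x := by
      have hterm (k : ℕ) : HasDerivAt
          (fun x => (((k + 1).factorial : 𝕜)⁻¹ * (x - z) ^ (k + 1)) • f (k + 1) z)
          (((k.factorial : 𝕜)⁻¹ * (x - z) ^ k) • f (k + 1) z) x := by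
        refine (((((hasDerivAt_id x).sub_const z).pow (k + 1)).const_mul _).congr_deriv
          ?_).smul_const _
        have := k.factorial_ne_zero
        simp only [Nat.factorial_succ, Nat.cast_mul, Nat.add_sub_cancel, id, mul_one]
        field_simp
      refine ((hf 0 n.succ_pos x hx.1).mono inter_subset_left).sub ?_
      simp only [Finset.sum_range_succ' _ n, pow_zero]
      exact ((HasDerivAt.fun_sum fun k _ => hterm k).add_const _).hasDerivWithinAt
    have hbound (x : 𝕜) (hx : x ∈ t) :
        ‖f 1 x - ∑ k ∈ Finset.range n, ((k.factorial : 𝕜)⁻¹ * (x - z) ^ k) • f (k + 1) z‖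
          ≤ M * ‖w - z‖ ^ n := by
      refine (ih hx.1 (f := fun k => f (k + 1)) (fun k hk => hf (k + 1) (by lia)) hM).trans ?_
      gcongr
      exact mem_closedBall_iff_norm.1 hx.2
    have hmean := (hs.inter (convex_closedBall z _)).norm_image_sub_le_of_norm_hasDerivWithin_le
      hderiv hbound hzt hwt
    simpa [Finset.sum_range_succ' _ n, pow_succ, mul_assoc] using hmean

variable {F : ℂ × ℂ → ℂ} {z₀ : ℂ} {r ρ : ℝ}

lemma mk_conj_mem_ball_of_mem_closedBall (hρ : ρ < r) {p : ℂ × ℂ}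
    (hp : p ∈ closedBall (z₀, z₀) ρ) :
    (p.1, conj p.2) ∈ ball (z₀, conj z₀) r ∧ (p.1, conj p.1) ∈ ball (z₀, conj z₀) r ∧
      (p.2, conj p.2) ∈ ball (z₀, conj z₀) r := by
  rw [← closedBall_prod_same, Set.mem_prod] at hp
  have h₁ := closedBall_subset_ball hρ hp.1
  have h₂ := closedBall_subset_ball hρ hp.2
  exact ⟨mk_conj_mem_ball.2 ⟨h₁, h₂⟩, mk_conj_mem_ball.2 ⟨h₁, h₁⟩, mk_conj_mem_ball.2 ⟨h₂, h₂⟩⟩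

lemma isBigO_one_comp_mk_conj (hF : ContinuousOn F (ball (z₀, conj z₀) r)) (hρ : ρ < r) :
    (fun p : ℂ × ℂ => F (p.1, conj p.2)) =O[𝓟 (closedBall (z₀, z₀) ρ)] fun _ => (1 : ℂ) :=
  (hF.comp (by fun_prop) fun _ hp => (mk_conj_mem_ball_of_mem_closedBall hρ hp).1)
    |>.isBigO_principal (isCompact_closedBall _ _) (by simp)

lemma isBigO_one_comp_mk_conj_self (hF : ContinuousOn F (ball (z₀, conj z₀) r)) (hρ : ρ < r) :
    (fun p : ℂ × ℂ => F (p.1, conj p.1)) =O[𝓟 (closedBall (z₀, z₀) ρ)] fun _ => (1 : ℂ) :=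
  (hF.comp (by fun_prop) fun _ hp => (mk_conj_mem_ball_of_mem_closedBall hρ hp).2.1)
    |>.isBigO_principal (isCompact_closedBall _ _) (by simp)

lemma differentiableOn_iterate_partialFst {Ω : Set (ℂ × ℂ)} (hΩ : IsOpen Ω)
    (hF : DifferentiableOn ℂ F Ω) (n : ℕ) : DifferentiableOn ℂ (partialFst^[n] F) Ω := by
  induction n with
  | zero => exact hF
  | succ n ih =>
    rw [Function.iterate_succ_apply']
    exact differentiableOn_partialFst hΩ ih

lemma isBigO_sub_taylor_sum_fst (hF : DifferentiableOn ℂ F (ball (z₀, conj z₀) r)) (hρ : ρ < r)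
    (n : ℕ) :
    (fun p : ℂ × ℂ => F (p.2, conj p.2) - ∑ k ∈ Finset.range n,
        ((k.factorial : ℂ)⁻¹ * (p.2 - p.1) ^ k) * partialFst^[k] F (p.1, conj p.2))
      =O[𝓟 (closedBall (z₀, z₀) ρ)] fun p => (p.2 - p.1) ^ n := by
  have hFk := differentiableOn_iterate_partialFst isOpen_ball hF
  obtain ⟨M, hM⟩ := isBigO_principal.1 (isBigO_one_comp_mk_conj (hFk n).continuousOn hρ)
  refine isBigO_principal.2 ⟨M, fun p hp => ?_⟩
  rw [← closedBall_prod_same, Set.mem_prod] at hp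
  have hmem {x : ℂ} (hx : x ∈ closedBall z₀ ρ) : (x, p.2) ∈ closedBall (z₀, z₀) ρ :=
    closedBall_prod_same z₀ z₀ ρ ▸ mk_mem_prod hx hp.2
  rw [norm_pow]
  refine norm_sub_taylor_sum_le (convex_closedBall z₀ ρ) hp.1 hp.2
    (f := fun k x => partialFst^[k] F (x, conj p.2)) (fun k _ x hx => ?_) fun x hx => ?_
  · simp only [Function.iterate_succ_apply']
    exact (hasDerivAt_partialFst ((hFk k).differentiableAt (isOpen_ball.mem_nhds
      (mk_conj_mem_ball_of_mem_closedBall hρ (hmem hx)).1))).hasDerivWithinAt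
  · simpa using hM _ (hmem hx)

lemma isBigO_sub_snd (hF : DifferentiableOn ℂ F (ball (z₀, conj z₀) r)) (hρ : ρ < r) :
    (fun p : ℂ × ℂ => F (p.1, conj p.1) - F (p.1, conj p.2))
      =O[𝓟 (closedBall (z₀, z₀) ρ)] fun p => p.2 - p.1 := by
  obtain ⟨M, hM⟩ := isBigO_principal.1 (isBigO_one_comp_mk_conj
    (differentiableOn_partialSnd isOpen_ball hF).continuousOn hρ)
  refine isBigO_principal.2 ⟨M, fun p hp => ?_⟩
  rw [← closedBall_prod_same, Set.mem_prod] at hp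
  have hmem {v : ℂ} (hv : v ∈ closedBall (conj z₀) ρ) :
      (p.1, conj v) ∈ closedBall (z₀, z₀) ρ := by
    rw [← closedBall_prod_same]
    refine ⟨hp.1, ?_⟩
    rwa [mem_closedBall_iff_norm, ← RCLike.norm_conj, map_sub, Complex.conj_conj,
      ← mem_closedBall_iff_norm]
  have hconj {x : ℂ} (hx : x ∈ closedBall z₀ ρ) : conj x ∈ closedBall (conj z₀) ρ := by
    rwa [mem_closedBall_iff_norm, ← map_sub, RCLike.norm_conj, ← mem_closedBall_iff_norm]
  have hderiv (v : ℂ) (hv : v ∈ closedBall (conj z₀) ρ) :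
      HasDerivWithinAt (fun v => F (p.1, v)) (partialSnd F (p.1, v)) (closedBall (conj z₀) ρ)
        v := by
    have hball := (mk_conj_mem_ball_of_mem_closedBall hρ (hmem hv)).1
    rw [Complex.conj_conj] at hball
    exact (hasDerivAt_partialSnd (p := (p.1, v))
      (hF.differentiableAt (isOpen_ball.mem_nhds hball))).hasDerivWithinAt
  have hbound (v : ℂ) (hv : v ∈ closedBall (conj z₀) ρ) : ‖partialSnd F (p.1, v)‖ ≤ M := by
    simpa using hM _ (hmem hv)
  have hmean := (convex_closedBall (conj z₀) ρ).norm_image_sub_le_of_norm_hasDerivWithin_le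
    hderiv hbound (hconj hp.1) (hconj hp.2)
  rw [← map_sub, RCLike.norm_conj] at hmean
  exact (norm_sub_rev _ _).trans_le hmean

end TaylorEstimates

section AmplitudeAlgebra

variable {α : Type*} {l : Filter α} {ζ W a a' b b₁ b₂ c k : α → ℂ}

lemma isBigO_one_sub_mul (hζ : ζ =O[l] fun _ => (1 : ℂ)) (hc : c =O[l] fun _ => (1 : ℂ)) :
    (fun x => 1 - c x * ζ x) =O[l] fun _ => (1 : ℂ) :=
  (isBigO_refl _ l).sub (by simpa using hc.mul hζ)

lemma isBigO_linear_amplitude_error (hζ : ζ =O[l] fun _ => (1 : ℂ)) (hW : W =O[l] ζ)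
    (hb₁ : b₁ =O[l] fun _ => (1 : ℂ)) (hb₂ : b₂ =O[l] fun _ => (1 : ℂ))
    (hc : c =O[l] fun _ => (1 : ℂ)) (hk : k =O[l] fun _ => (1 : ℂ))
    (ha : (fun x => a x - ζ x * b x - ζ x ^ 2 / 2 * b₁ x) =O[l] fun x => ζ x ^ 3)
    (ha' : (fun x => a' x - ζ x * b₂ x) =O[l] fun x => ζ x ^ 2)
    (hcb : (fun x => c x * b x - b₁ x) =O[l] ζ) :
    (fun x => (1 - c x * ζ x) * (2 * a x + W x * a' x)
        - ζ x * (2 * b x - ζ x * b₁ x + W x * b₂ x + ζ x * W x * k x))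
      =O[l] fun x => ζ x ^ 3 := by
  have hζζ (n : ℕ) : (fun x => ζ x ^ n) =O[l] fun x => ζ x ^ n := isBigO_refl _ l
  have h₁ : (fun x => -2 * (ζ x ^ 2 * (c x * b x - b₁ x))) =O[l] fun x => ζ x ^ 3 :=
    (((hζζ 2).mul hcb).congr_right fun x => by ring).const_mul_left _
  have h₂ : (fun x => ζ x ^ 3 * (c x * b₁ x)) =O[l] fun x => ζ x ^ 3 :=
    ((hζζ 3).mul (hc.mul hb₁)).congr_right fun x => by ring
  have h₃ : (fun x => (1 - c x * ζ x)
      * (2 * (a x - ζ x * b x - ζ x ^ 2 / 2 * b₁ x) + W x * (a' x - ζ x * b₂ x)))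
      =O[l] fun x => ζ x ^ 3 :=
    ((isBigO_one_sub_mul hζ hc).mul ((ha.const_mul_left 2).add
      ((hW.mul ha').congr_right fun x => by ring))).congr_right fun x => by ring
  have h₄ : (fun x => ζ x ^ 2 * W x * (c x * b₂ x + k x)) =O[l] fun x => ζ x ^ 3 :=
    (((hζζ 2).mul hW).mul (((hc.mul hb₂).congr_right fun _ => one_mul 1).add hk)).congr_right
      fun x => by ring
  refine (((h₁.sub h₂).add h₃).sub h₄).congr_left fun x => ?_
  ring

lemma isBigO_quadratic_amplitude_error (hζ : ζ =O[l] fun _ => (1 : ℂ)) (hW : W =O[l] ζ)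
    (hb : b =O[l] fun _ => (1 : ℂ)) (hb₁ : b₁ =O[l] fun _ => (1 : ℂ))
    (hc : c =O[l] fun _ => (1 : ℂ))
    (ha : (fun x => a x - ζ x * b x - ζ x ^ 2 / 2 * b₁ x) =O[l] fun x => ζ x ^ 3)
    (hcb : (fun x => c x * b x - b₁ x) =O[l] ζ) :
    (fun x => W x * ((1 - c x * ζ x) * a x ^ 2 - ζ x ^ 2 * b x ^ 2)) =O[l] fun x => ζ x ^ 5 := by
  have hζζ (n : ℕ) : (fun x => ζ x ^ n) =O[l] fun x => ζ x ^ n := isBigO_refl _ l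
  have hσ : (fun x => a x - ζ x * b x) =O[l] fun x => ζ x ^ 2 := by
    have h₁ : (fun x => ζ x ^ 2 / 2 * b₁ x) =O[l] fun x => ζ x ^ 2 :=
      ((((hζζ 2).mul hb₁).congr_right fun x => by ring).const_mul_left (1 / 2)).congr_left
        fun x => by ring
    have h₂ : (fun x => ζ x ^ 3) =O[l] fun x => ζ x ^ 2 :=
      ((hζζ 2).mul hζ).congr (fun x => by ring) fun x => by ring
    exact ((ha.trans h₂).add h₁).congr_left fun x => by ring
  have h₁ : (fun x => ζ x ^ 3 * (b x * (c x * b x - b₁ x))) =O[l] fun x => ζ x ^ 4 :=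
    ((hζζ 3).mul (hb.mul hcb)).congr_right fun x => by ring
  have h₂ : (fun x => 2 * (ζ x * (b x * (a x - ζ x * b x - ζ x ^ 2 / 2 * b₁ x))))
      =O[l] fun x => ζ x ^ 4 :=
    (((isBigO_refl ζ l).mul (hb.mul ha)).congr_right fun x => by ring).const_mul_left _
  have h₃ : (fun x => (1 - c x * ζ x) * (a x - ζ x * b x) ^ 2) =O[l] fun x => ζ x ^ 4 :=
    ((isBigO_one_sub_mul hζ hc).mul (hσ.pow 2)).congr_right fun x => by ring
  have h₄ : (fun x => 2 * (c x * ζ x ^ 2 * (b x * (a x - ζ x * b x)))) =O[l] fun x => ζ x ^ 4 :=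
    (((hc.mul (hζζ 2)).mul (hb.mul hσ)).congr_right fun x => by ring).const_mul_left _
  refine (hW.mul (((h₂.sub h₁).add h₃).sub h₄)).congr (fun x => ?_) fun x => by ring
  ring

end AmplitudeAlgebra

section ErrorAmplitude

variable {Q : ℂ → ℝ} {P : ℂ → ℂ → ℂ} {X : ℂ → ℂ} {z₀ : ℂ} {r ρ κ : ℝ}

/-- The function `-∂̄_w (P(z, w) - Q(w))`, which enters every `∂̄`-derivative of
`e^{m (P(z, w) - Q(w))}`. -/
def phaseBar (P : ℂ → ℂ → ℂ) (z w : ℂ) : ℂ :=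
  partialSnd (polar P) (w, conj w) - partialSnd (polar P) (z, conj w)

/-- The function `∂̄_w phaseBar(z, w)`. -/
def phaseBarBar (P : ℂ → ℂ → ℂ) (z w : ℂ) : ℂ :=
  partialSnd (partialSnd (polar P)) (w, conj w) - partialSnd (partialSnd (polar P)) (z, conj w)

/-- The logarithmic derivative `∂_z b / b`, as a holomorphic function of `(z, w̄)`. -/
def logDerivB (P : ℂ → ℂ → ℂ) (p : ℂ × ℂ) : ℂ := partialFst (bHol P) p / bHol P p

/-- The factor of the test function that is holomorphic in `w`; it equals `1` at `w = z`. -/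
def holFactor (P : ℂ → ℂ → ℂ) (z w : ℂ) : ℂ := 1 - logDerivB P (z, conj z) * (w - z)

/-- The amplitude of the difference between the Cauchy-Pompeiu integrand and the kernel,
multiplied by `w - z` in order to have no singularity on the diagonal. -/
def errorAmplitude (X : ℂ → ℂ) (P : ℂ → ℂ → ℂ) (m : ℝ) (z w : ℂ) : ℂ :=
  -(2 * (wirtBar X w - m * phaseBar P z w * X w)
      + (conj w - conj z) * (wirtBar (wirtBar X) w - 2 * m * phaseBar P z w * wirtBar X w
        + (m ^ 2 * phaseBar P z w ^ 2 - m * phaseBarBar P z w) * X w)) * holFactor P z w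
    - (w - z) * (X w * (m ^ 2 * coeff0 P z w + m * coeff1 P z w))

namespace IsDecayingPolarization

lemma differentiableOn_logDerivB (h : IsDecayingPolarization Q P z₀ r κ) :
    DifferentiableOn ℂ (logDerivB P) (ball (z₀, conj z₀) r) := by
  have hb := h.differentiableOn_bHol
  have hb₁ := differentiableOn_partialFst isOpen_ball hb
  have hinv : DifferentiableOn ℂ (fun p => (bHol P p)⁻¹) (ball (z₀, conj z₀) r) :=
    hb.inv fun _ => h.bHol_ne
  unfold logDerivB
  simp only [div_eq_mul_inv]
  fun_prop

lemma isBigO_phaseBar_sub (h : IsDecayingPolarization Q P z₀ r κ) (hρ : ρ < r) :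
    (fun p : ℂ × ℂ => phaseBar P p.1 p.2 - (p.2 - p.1) * bHol P (p.1, conj p.2)
        - (p.2 - p.1) ^ 2 / 2 * partialFst (bHol P) (p.1, conj p.2))
      =O[𝓟 (closedBall (z₀, z₀) ρ)] fun p => (p.2 - p.1) ^ 3 := by
  refine (isBigO_sub_taylor_sum_fst (differentiableOn_partialSnd isOpen_ball
    h.differentiableOn_polar) hρ 3).congr_left fun p => ?_
  simp only [Finset.sum_range_succ, Finset.sum_range_zero, Nat.factorial, Function.iterate_succ,
    Function.iterate_zero, Function.comp_apply, id, phaseBar, bHol]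
  push_cast
  ring

lemma isBigO_phaseBarBar_sub (h : IsDecayingPolarization Q P z₀ r κ) (hρ : ρ < r) :
    (fun p : ℂ × ℂ => phaseBarBar P p.1 p.2 - (p.2 - p.1) * partialSnd (bHol P) (p.1, conj p.2))
      =O[𝓟 (closedBall (z₀, z₀) ρ)] fun p => (p.2 - p.1) ^ 2 := by
  have hP₂ := differentiableOn_partialSnd isOpen_ball h.differentiableOn_polar
  refine (isBigO_sub_taylor_sum_fst (differentiableOn_partialSnd isOpen_ball hP₂) hρ 2).congr'
    (eventually_principal.2 fun p hp => ?_) (EventuallyEq.refl _ _)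
  simp only [Finset.sum_range_succ, Finset.sum_range_zero, Nat.factorial, Function.iterate_succ,
    Function.iterate_zero, Function.comp_apply, id, phaseBarBar, bHol,
    partialSnd_partialFst isOpen_ball hP₂ (mk_conj_mem_ball_of_mem_closedBall hρ hp).1]
  push_cast
  ring

lemma isBigO_logDerivB_mul_sub (h : IsDecayingPolarization Q P z₀ r κ) (hρ : ρ < r) :
    (fun p : ℂ × ℂ => logDerivB P (p.1, conj p.1) * bHol P (p.1, conj p.2)
        - partialFst (bHol P) (p.1, conj p.2))
      =O[𝓟 (closedBall (z₀, z₀) ρ)] fun p => p.2 - p.1 := by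
  refine ((isBigO_sub_snd h.differentiableOn_logDerivB hρ).mul
    (isBigO_one_comp_mk_conj h.differentiableOn_bHol.continuousOn hρ)).congr'
    (eventually_principal.2 fun p hp => ?_) (.of_forall fun p => mul_one _)
  have hb := h.bHol_ne (mk_conj_mem_ball_of_mem_closedBall hρ hp).1
  simp only [sub_mul, logDerivB, div_mul_cancel₀ _ hb]

end IsDecayingPolarization

lemma isBigO_one_snd_sub_fst (z₀ : ℂ) (ρ : ℝ) :
    (fun p : ℂ × ℂ => p.2 - p.1) =O[𝓟 (closedBall (z₀, z₀) ρ)] fun _ => (1 : ℂ) :=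
  (Continuous.continuousOn (by fun_prop)).isBigO_principal (isCompact_closedBall _ _) (by simp)

lemma isBigO_conj_sub_conj (l : Filter (ℂ × ℂ)) :
    (fun p : ℂ × ℂ => conj p.2 - conj p.1) =O[l] fun p => p.2 - p.1 :=
  isBigO_of_le _ fun p => by rw [← map_sub, RCLike.norm_conj]

namespace IsDecayingPolarization

lemma isBigO_one_holFactor (h : IsDecayingPolarization Q P z₀ r κ) (hρ : ρ < r) :
    (fun p : ℂ × ℂ => holFactor P p.1 p.2) =O[𝓟 (closedBall (z₀, z₀) ρ)] fun _ => (1 : ℂ) :=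
  isBigO_one_sub_mul (isBigO_one_snd_sub_fst z₀ ρ)
    (isBigO_one_comp_mk_conj_self h.differentiableOn_logDerivB.continuousOn hρ)

lemma isBigO_one_phaseBar (h : IsDecayingPolarization Q P z₀ r κ) (hρ : ρ < r) :
    (fun p : ℂ × ℂ => phaseBar P p.1 p.2) =O[𝓟 (closedBall (z₀, z₀) ρ)] fun _ => (1 : ℂ) := by
  have hP₂ := (differentiableOn_partialSnd isOpen_ball h.differentiableOn_polar).continuousOn
  exact ((hP₂.comp (by fun_prop) fun _ hp => (mk_conj_mem_ball_of_mem_closedBall hρ hp).2.2).sub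
    (hP₂.comp (by fun_prop) fun _ hp => (mk_conj_mem_ball_of_mem_closedBall hρ hp).1))
    |>.isBigO_principal (isCompact_closedBall _ _) (by simp)

lemma isBigO_linear_error (h : IsDecayingPolarization Q P z₀ r κ) (hρ : ρ < r) :
    (fun p : ℂ × ℂ => holFactor P p.1 p.2
        * (2 * phaseBar P p.1 p.2 + (conj p.2 - conj p.1) * phaseBarBar P p.1 p.2)
        - (p.2 - p.1) * coeff1 P p.1 p.2)
      =O[𝓟 (closedBall (z₀, z₀) ρ)] fun p => (p.2 - p.1) ^ 3 := by
  have hb := h.differentiableOn_bHol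
  refine (isBigO_linear_amplitude_error (isBigO_one_snd_sub_fst z₀ ρ) (isBigO_conj_sub_conj _)
    (isBigO_one_comp_mk_conj (differentiableOn_partialFst isOpen_ball hb).continuousOn hρ)
    (isBigO_one_comp_mk_conj (differentiableOn_partialSnd isOpen_ball hb).continuousOn hρ)
    (isBigO_one_comp_mk_conj_self h.differentiableOn_logDerivB.continuousOn hρ)
    (isBigO_one_comp_mk_conj h.differentiableOn_mixedCoeff.continuousOn hρ)
    (h.isBigO_phaseBar_sub hρ) (h.isBigO_phaseBarBar_sub hρ)
    (h.isBigO_logDerivB_mul_sub hρ)).congr' (eventually_principal.2 fun p hp => ?_)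
    (EventuallyEq.refl _ _)
  obtain ⟨hz, hw⟩ := mk_conj_mem_ball.1 (mk_conj_mem_ball_of_mem_closedBall hρ hp).1
  simp only [h.coeff1_eq hz hw, holFactor]
  ring

lemma isBigO_quadratic_error (h : IsDecayingPolarization Q P z₀ r κ) (hρ : ρ < r) :
    (fun p : ℂ × ℂ => (conj p.2 - conj p.1) * holFactor P p.1 p.2 * phaseBar P p.1 p.2 ^ 2
        + (p.2 - p.1) * coeff0 P p.1 p.2)
      =O[𝓟 (closedBall (z₀, z₀) ρ)] fun p => (p.2 - p.1) ^ 5 := by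
  have hb := h.differentiableOn_bHol
  refine (isBigO_quadratic_amplitude_error (isBigO_one_snd_sub_fst z₀ ρ) (isBigO_conj_sub_conj _)
    (isBigO_one_comp_mk_conj hb.continuousOn hρ)
    (isBigO_one_comp_mk_conj (differentiableOn_partialFst isOpen_ball hb).continuousOn hρ)
    (isBigO_one_comp_mk_conj_self h.differentiableOn_logDerivB.continuousOn hρ)
    (h.isBigO_phaseBar_sub hρ) (h.isBigO_logDerivB_mul_sub hρ)).congr'
    (eventually_principal.2 fun p hp => ?_) (EventuallyEq.refl _ _)
  obtain ⟨hz, hw⟩ := mk_conj_mem_ball.1 (mk_conj_mem_ball_of_mem_closedBall hρ hp).1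
  simp only [h.coeff0_eq hz hw, holFactor]
  ring

end IsDecayingPolarization

end ErrorAmplitude

section ErrorBound

variable {Q : ℂ → ℝ} {P : ℂ → ℂ → ℂ} {X : ℂ → ℂ} {z₀ : ℂ} {r ρ s R κ : ℝ}

lemma isBigO_pow_of_eq_zero_on_ball {g : ℂ → ℂ} (hg : Continuous g)
    (hzero : ∀ w ∈ ball z₀ R, g w = 0) (hsR : s < R) (ρ : ℝ) (n : ℕ) :
    (fun p : ℂ × ℂ => g p.2)
      =O[𝓟 (ball z₀ s ×ˢ closedBall z₀ ρ)] fun p => (p.2 - p.1) ^ n := by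
  obtain ⟨M, hM⟩ := (isCompact_closedBall z₀ ρ).exists_bound_of_continuousOn hg.continuousOn
  refine isBigO_principal.2 ⟨M / (R - s) ^ n, fun p hp => ?_⟩
  have := sub_pos.2 hsR
  have hM₀ : 0 ≤ M := (norm_nonneg _).trans (hM _ hp.2)
  by_cases hw : p.2 ∈ ball z₀ R
  · rw [hzero _ hw, norm_zero]
    positivity
  · have hdist : R - s ≤ ‖p.2 - p.1‖ := by
      rw [mem_ball, not_lt] at hw
      rw [← dist_eq_norm]
      linarith [dist_triangle p.2 p.1 z₀, mem_ball.1 hp.1]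
    rw [norm_pow, div_mul_eq_mul_div, le_div_iff₀ (by positivity)]
    gcongr
    exact hM _ hp.2

lemma wirtBar_eq_zero_of_eq_const_on_ball {c : ℂ} (hX : ∀ w ∈ ball z₀ R, X w = c) :
    ∀ w ∈ ball z₀ R, wirtBar X w = 0 := fun w hw => by
  rw [wirtBar_congr (eventuallyEq_of_mem (isOpen_ball.mem_nhds hw) hX)]
  exact (HasWirtBarAt.const c w).wirtBar_eq

lemma exists_norm_add_mul_add_sq_mul_le {α : Type*} {S : Set α} {f₀ f₁ f₂ ζ : α → ℂ}
    (h₀ : f₀ =O[𝓟 S] fun x => ζ x ^ 3) (h₁ : f₁ =O[𝓟 S] fun x => ζ x ^ 3)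
    (h₂ : f₂ =O[𝓟 S] fun x => ζ x ^ 5) :
    ∃ C, 0 ≤ C ∧ ∀ m : ℝ, 1 ≤ m → ∀ x ∈ S, ‖f₀ x + m * f₁ x + m ^ 2 * f₂ x‖
      ≤ C * ‖ζ x‖ * (m * ‖ζ x‖ ^ 2 + (m * ‖ζ x‖ ^ 2) ^ 2) := by
  obtain ⟨C₀, hC₀, h₀⟩ := h₀.exists_nonneg
  obtain ⟨C₁, hC₁, h₁⟩ := h₁.exists_nonneg
  obtain ⟨C₂, hC₂, h₂⟩ := h₂.exists_nonneg
  rw [isBigOWith_principal] at h₀ h₁ h₂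
  refine ⟨C₀ + C₁ + C₂, by positivity, fun m hm x hx => ?_⟩
  have hm₀ : 0 ≤ m := zero_le_one.trans hm
  have h₀ := h₀ x hx
  have h₁ := h₁ x hx
  have h₂ := h₂ x hx
  rw [norm_pow] at h₀ h₁ h₂
  calc ‖f₀ x + m * f₁ x + m ^ 2 * f₂ x‖ ≤ ‖f₀ x‖ + m * ‖f₁ x‖ + m ^ 2 * ‖f₂ x‖ := by
        refine norm_add₃_le.trans_eq ?_
        simp only [norm_mul, norm_pow, Complex.norm_real, Real.norm_of_nonneg hm₀]
    _ ≤ m * (C₀ * ‖ζ x‖ ^ 3) + m * (C₁ * ‖ζ x‖ ^ 3) + m ^ 2 * (C₂ * ‖ζ x‖ ^ 5) := by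
        gcongr
        exact h₀.trans (le_mul_of_one_le_left (by positivity) hm)
    _ ≤ (C₀ + C₁ + C₂) * (m * ‖ζ x‖ ^ 3) + (C₀ + C₁ + C₂) * (m ^ 2 * ‖ζ x‖ ^ 5) := by
        nlinarith [show 0 ≤ m * ‖ζ x‖ ^ 3 by positivity, show 0 ≤ m ^ 2 * ‖ζ x‖ ^ 5 by positivity]
    _ = (C₀ + C₁ + C₂) * ‖ζ x‖ * (m * ‖ζ x‖ ^ 2 + (m * ‖ζ x‖ ^ 2) ^ 2) := by ring

lemma IsDecayingPolarization.exists_norm_errorAmplitude_le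
    (h : IsDecayingPolarization Q P z₀ r κ) (hX : IsTest univ X)
    (hone : ∀ w ∈ ball z₀ R, X w = 1) (hsR : s < R) (hsρ : s ≤ ρ) (hρ : ρ < r) :
    ∃ C, 0 ≤ C ∧ ∀ m : ℝ, 1 ≤ m → ∀ z ∈ ball z₀ s, ∀ w ∈ closedBall z₀ ρ,
      ‖errorAmplitude X P m z w‖
        ≤ C * ‖w - z‖ * (m * ‖w - z‖ ^ 2 + (m * ‖w - z‖ ^ 2) ^ 2) := by
  have hsub : 𝓟 (ball z₀ s ×ˢ closedBall z₀ ρ) ≤ 𝓟 (closedBall (z₀, z₀) ρ) := by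
    rw [← closedBall_prod_same]
    exact principal_mono.2 (prod_mono (ball_subset_closedBall.trans
      (closedBall_subset_closedBall hsρ)) Subset.rfl)
  have hX₀ : (fun p : ℂ × ℂ => X p.2) =O[𝓟 (closedBall (z₀, z₀) ρ)] fun _ => (1 : ℂ) :=
    (hX.smooth.continuous.comp continuous_snd).continuousOn.isBigO_principal
      (isCompact_closedBall _ _) (by simp)
  have hzero₁ := wirtBar_eq_zero_of_eq_const_on_ball hone
  have hX₁ := isBigO_pow_of_eq_zero_on_ball hX.wirtBar.smooth.continuous hzero₁ hsR ρ 3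
  have hX₂ := isBigO_pow_of_eq_zero_on_ball hX.wirtBar.wirtBar.smooth.continuous
    (wirtBar_eq_zero_of_eq_const_on_ball hzero₁) hsR ρ 3
  have hL := (h.isBigO_one_holFactor hρ).mono hsub
  have ha := (h.isBigO_one_phaseBar hρ).mono hsub
  have hW := ((isBigO_conj_sub_conj _).trans (isBigO_one_snd_sub_fst z₀ ρ)).mono hsub
  have hcut₀ := ((hX₁.const_mul_left 2).add ((hW.mul hX₂).congr_right fun p => one_mul _)).mul hL
  have hcut₁ := ((hW.mul ha).mul (hX₁.mul hL)).const_mul_left 2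
  have hlin := (hX₀.mul (h.isBigO_linear_error hρ)).mono hsub
  have hquad := (hX₀.mul (h.isBigO_quadratic_error hρ)).mono hsub
  obtain ⟨C, hC, hbound⟩ := exists_norm_add_mul_add_sq_mul_le
    (hcut₀.neg_left.congr_right fun p => mul_one _)
    ((hlin.congr_right fun p => one_mul _).add (hcut₁.congr_right fun p => by ring))
    (hquad.neg_left.congr_right fun p => one_mul _)
  refine ⟨C, hC, fun m hm z hz w hw => ?_⟩
  convert hbound m hm (z, w) ⟨hz, hw⟩ using 2
  rw [errorAmplitude]
  ring

end ErrorBound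

section Cutoff

variable {χ₀ : ℝ → ℝ} {z₀ : ℂ} {r : ℝ}

lemma IsCutoffProfile.cutoff_eq_one (hχ : IsCutoffProfile χ₀) {w : ℂ}
    (hw : w ∈ ball z₀ (2 * r / 3)) : cutoff χ₀ z₀ r w = 1 := by
  have hwr : ‖w - z₀‖ < 2 * r / 3 := mem_ball_iff_norm.1 hw
  have hr : 0 < r := by linarith [norm_nonneg (w - z₀)]
  refine hχ.eq_one _ ⟨lt_of_lt_of_le (by norm_num) (by positivity : 0 ≤ ‖w - z₀‖ / r), ?_⟩
  rw [div_lt_iff₀ hr]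
  linarith

lemma IsCutoffProfile.contDiff_cutoff (hχ : IsCutoffProfile χ₀) (z₀ : ℂ) (hr : 0 < r) :
    ContDiff ℝ ∞ fun w => (cutoff χ₀ z₀ r w : ℂ) := by
  refine contDiff_iff_contDiffAt.2 fun w => ?_
  obtain rfl | hw := eq_or_ne w z₀
  · refine (contDiffAt_const (c := (1 : ℂ))).congr_of_eventuallyEq ?_
    filter_upwards [ball_mem_nhds w (by positivity : 0 < 2 * r / 3)] with x hx
    rw [hχ.cutoff_eq_one hx, Complex.ofReal_one]
  · exact Complex.ofRealCLM.contDiff.contDiffAt.comp w (hχ.smooth.contDiffAt.comp w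
      (((contDiffAt_id.sub contDiffAt_const).norm ℝ (sub_ne_zero.2 hw)).div_const r))

lemma IsCutoffProfile.isTest_cutoff (hχ : IsCutoffProfile χ₀) (z₀ : ℂ) (hr : 0 < r) :
    IsTest (ball z₀ r) fun w => (cutoff χ₀ z₀ r w : ℂ) := by
  have hsupp : tsupport (fun w => (cutoff χ₀ z₀ r w : ℂ)) ⊆ ball z₀ r := fun w hw => by
    have hmem : ‖w - z₀‖ / r ∈ tsupport χ₀ := by
      refine closure_minimal (t := (fun w => ‖w - z₀‖ / r) ⁻¹' tsupport χ₀) (fun w hw => ?_)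
        ((isClosed_tsupport _).preimage (by fun_prop)) hw
      exact subset_tsupport _ fun h => hw (by simp only [cutoff, h, Complex.ofReal_zero])
    have := (hχ.supp hmem).2
    rwa [div_lt_one hr, ← mem_ball_iff_norm] at this
  exact ⟨hχ.contDiff_cutoff z₀ hr, isCompact_of_isClosed_isBounded (isClosed_tsupport _)
    (isBounded_ball.subset hsupp), hsupp⟩

end Cutoff

section TestFactor

variable {Q : ℂ → ℝ} {P : ℂ → ℂ → ℂ} {X : ℂ → ℂ} {z₀ z w : ℂ} {r κ : ℝ}

/-- The exponential `e^{m (P(z, w) - Q(w))}` common to the kernel, with its weight, and to the test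
function. -/
def expPhase (Q : ℂ → ℝ) (P : ℂ → ℂ → ℂ) (m : ℝ) (z w : ℂ) : ℂ :=
  Complex.exp (m * (P z w - Q w))

/-- The test function, with cut-off `X`, to which the Cauchy-Pompeiu formula is applied. -/
def testFactor (X : ℂ → ℂ) (Q : ℂ → ℝ) (P : ℂ → ℂ → ℂ) (m : ℝ) (z w : ℂ) : ℂ :=
  holFactor P z w * expPhase Q P m z w * X w

lemma hasWirtBarAt_holFactor (P : ℂ → ℂ → ℂ) (z w : ℂ) : HasWirtBarAt (holFactor P z) 0 w :=
  .of_hasDerivAt ((((hasDerivAt_id w).sub_const z).const_mul _).const_sub 1)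

lemma twoTermKernel_mul_exp (Q : ℂ → ℝ) (P : ℂ → ℂ → ℂ) (m : ℝ) (z w : ℂ) :
    twoTermKernel P m z w * (Real.exp (-(m * Q w)) : ℂ)
      = (m ^ 2 * coeff0 P z w + m * coeff1 P z w) * expPhase Q P m z w := by
  rw [twoTermKernel, expPhase, mul_assoc, Complex.ofReal_exp, ← Complex.exp_add]
  push_cast
  ring_nf

namespace IsDecayingPolarization

lemma norm_expPhase_le (h : IsDecayingPolarization Q P z₀ r κ) {m : ℝ} (hm : 0 ≤ m)
    (hz : z ∈ ball z₀ r) (hw : w ∈ ball z₀ r) :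
    ‖expPhase Q P m z w‖
      ≤ Real.exp (m * Q z / 2) * Real.exp (-(m * Q w) / 2)
        * Real.exp (-(κ / 2) * (m * ‖w - z‖ ^ 2)) := by
  rw [expPhase, Complex.norm_exp, ← Real.exp_add, ← Real.exp_add, Real.exp_le_exp,
    Complex.re_ofReal_mul, Complex.sub_re, Complex.ofReal_re]
  linarith [mul_le_mul_of_nonneg_left (h.decay z hz w hw) hm]

lemma contDiffOn_ofReal (h : IsDecayingPolarization Q P z₀ r κ) :
    ContDiffOn ℝ ∞ (fun w => (Q w : ℂ)) (ball z₀ r) :=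
  Complex.ofRealCLM.contDiff.comp_contDiffOn (h.analytic.contDiffOn isOpen_ball.uniqueDiffOn)

lemma contDiffOn_expPhase (h : IsDecayingPolarization Q P z₀ r κ) (m : ℝ) (hz : z ∈ ball z₀ r) :
    ContDiffOn ℝ ∞ (expPhase Q P m z) (ball z₀ r) := by
  have hP : ContDiffOn ℝ ∞ (fun w => conj (conj (P z w))) (ball z₀ r) :=
    Complex.conjCLE.contDiff.comp_contDiffOn
      (((h.antianalytic_snd z hz).contDiffOn isOpen_ball.uniqueDiffOn).restrict_scalars ℝ)
  simp only [Complex.conj_conj] at hP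
  exact (contDiffOn_const.mul (hP.sub h.contDiffOn_ofReal)).cexp

lemma isTest_testFactor (h : IsDecayingPolarization Q P z₀ r κ) (hX : IsTest (ball z₀ r) X)
    (m : ℝ) (hz : z ∈ ball z₀ r) : IsTest (ball z₀ r) (testFactor X Q P m z) := by
  have hL : ContDiff ℝ ∞ (holFactor P z) := by
    unfold holFactor
    fun_prop
  exact hX.contDiffOn_mul isOpen_ball (hL.contDiffOn.mul (h.contDiffOn_expPhase m hz))

lemma testFactor_self (h : IsDecayingPolarization Q P z₀ r κ) (m : ℝ) (hz : z ∈ ball z₀ r) :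
    testFactor X Q P m z z = X z := by
  simp only [testFactor, holFactor, expPhase, h.diag z hz, sub_self, mul_zero, sub_zero,
    Complex.exp_zero, one_mul]

lemma hasWirtBarAt_expPhase (h : IsDecayingPolarization Q P z₀ r κ) (m : ℝ)
    (hz : z ∈ ball z₀ r) (hw : w ∈ ball z₀ r) :
    HasWirtBarAt (expPhase Q P m z) (-(m * phaseBar P z w) * expPhase Q P m z w) w := by
  have hdiff {ζ : ℂ} (hζ : ζ ∈ ball z₀ r) : DifferentiableAt ℂ (polar P) (ζ, conj w) :=
    h.differentiableOn_polar.differentiableAt (isOpen_ball.mem_nhds (mk_conj_mem_ball.2 ⟨hζ, hw⟩))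
  have hP : HasWirtBarAt (P z) (partialSnd (polar P) (z, conj w)) w := by
    simpa only [polar, Complex.conj_conj] using hasWirtBarAt_comp_conj (hdiff hz)
  have hQ : HasWirtBarAt (fun w => (Q w : ℂ)) (partialSnd (polar P) (w, conj w)) w := by
    refine (hasWirtBarAt_comp_diag (hdiff hw)).congr_of_eventuallyEq ?_
    filter_upwards [isOpen_ball.mem_nhds hw] with x hx
    rw [polar, Complex.conj_conj, h.diag x hx]
  refine (HasWirtBarAt.comp (Complex.hasDerivAt_exp _)
    ((hP.sub hQ).const_mul (m : ℂ))).congr_wirtBar ?_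
  rw [phaseBar, expPhase]
  ring

lemma hasWirtBarAt_phaseBar (h : IsDecayingPolarization Q P z₀ r κ)
    (hz : z ∈ ball z₀ r) (hw : w ∈ ball z₀ r) :
    HasWirtBarAt (phaseBar P z) (phaseBarBar P z w) w := by
  have hdiff {ζ : ℂ} (hζ : ζ ∈ ball z₀ r) :
      DifferentiableAt ℂ (partialSnd (polar P)) (ζ, conj w) :=
    (differentiableOn_partialSnd isOpen_ball h.differentiableOn_polar).differentiableAt
      (isOpen_ball.mem_nhds (mk_conj_mem_ball.2 ⟨hζ, hw⟩))
  exact (hasWirtBarAt_comp_diag (hdiff hw)).sub (hasWirtBarAt_comp_conj (hdiff hz))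

lemma hasWirtBarAt_holFactor_mul_expPhase_mul (h : IsDecayingPolarization Q P z₀ r κ) (m : ℝ)
    (hz : z ∈ ball z₀ r) (hw : w ∈ ball z₀ r) {Y : ℂ → ℂ} {Y' : ℂ} (hY : HasWirtBarAt Y Y' w) :
    HasWirtBarAt (fun w => holFactor P z w * expPhase Q P m z w * Y w)
      (holFactor P z w * expPhase Q P m z w * (Y' - m * phaseBar P z w * Y w)) w :=
  (((hasWirtBarAt_holFactor P z w).mul (h.hasWirtBarAt_expPhase m hz hw)).mul hY).congr_wirtBar
    (by ring)

lemma wirtBar_testFactor (h : IsDecayingPolarization Q P z₀ r κ) (hX : ContDiff ℝ ∞ X) (m : ℝ)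
    (hz : z ∈ ball z₀ r) (hw : w ∈ ball z₀ r) :
    wirtBar (testFactor X Q P m z) w
      = holFactor P z w * expPhase Q P m z w * (wirtBar X w - m * phaseBar P z w * X w) :=
  (h.hasWirtBarAt_holFactor_mul_expPhase_mul m hz hw
    (.of_contDiffAt hX.contDiffAt)).wirtBar_eq

lemma wirtBar_wirtBar_testFactor (h : IsDecayingPolarization Q P z₀ r κ) (hX : IsTest univ X)
    (m : ℝ) (hz : z ∈ ball z₀ r) (hw : w ∈ ball z₀ r) :
    wirtBar (wirtBar (testFactor X Q P m z)) w
      = holFactor P z w * expPhase Q P m z w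
        * (wirtBar (wirtBar X) w - 2 * m * phaseBar P z w * wirtBar X w
          + (m ^ 2 * phaseBar P z w ^ 2 - m * phaseBarBar P z w) * X w) := by
  rw [wirtBar_congr (eventuallyEq_of_mem (isOpen_ball.mem_nhds hw) fun x hx =>
    h.wirtBar_testFactor hX.smooth m hz hx)]
  refine (h.hasWirtBarAt_holFactor_mul_expPhase_mul m hz hw
    ((HasWirtBarAt.of_contDiffAt (hX.wirtBar.contDiffAt w)).sub
      (((h.hasWirtBarAt_phaseBar hz hw).const_mul (m : ℂ)).mul
        (.of_contDiffAt (hX.contDiffAt w))))).wirtBar_eq.trans ?_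
  ring

lemma pompeiuIntegrand_testFactor_add (h : IsDecayingPolarization Q P z₀ r κ)
    (hX : IsTest univ X) (m : ℝ) (u : ℂ → ℂ) (hz : z ∈ ball z₀ r) (hw : w ∈ ball z₀ r)
    (hne : w ≠ z) :
    pompeiuIntegrand u (testFactor X Q P m z) z w
        + u w * X w * twoTermKernel P m z w * (Real.exp (-(m * Q w)) : ℂ)
      = -(u w * expPhase Q P m z w * (errorAmplitude X P m z w / (w - z))) := by
  have hwz : w - z ≠ 0 := sub_ne_zero.2 hne
  rw [mul_assoc (u w * X w), twoTermKernel_mul_exp, pompeiuIntegrand,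
    h.wirtBar_testFactor hX.smooth m hz hw, h.wirtBar_wirtBar_testFactor hX m hz hw,
    errorAmplitude, map_sub]
  field_simp
  ring

end IsDecayingPolarization

end TestFactor

section Gaussian

lemma add_sq_le_mul_exp {a t : ℝ} (ha : 0 < a) (ht : 0 ≤ t) :
    t + t ^ 2 ≤ (1 / a + 2 / a ^ 2) * Real.exp (a * t) := by
  have hquad := Real.quadratic_le_exp_of_nonneg (mul_nonneg ha.le ht)
  have hlin : a * t ≤ Real.exp (a * t) := by linarith [Real.add_one_le_exp (a * t)]
  calc t + t ^ 2 = 1 / a * (a * t) + 2 / a ^ 2 * ((a * t) ^ 2 / 2) := by field_simp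
    _ ≤ 1 / a * Real.exp (a * t) + 2 / a ^ 2 * Real.exp (a * t) := by
      gcongr
      linarith [mul_nonneg ha.le ht]
    _ = (1 / a + 2 / a ^ 2) * Real.exp (a * t) := by ring

lemma exp_neg_mul_sq_pow_two (b x : ℝ) :
    Real.exp (-b * x ^ 2) ^ 2 = Real.exp (-(2 * b) * x ^ 2) := by
  rw [← Real.exp_nat_mul]
  push_cast
  ring_nf

variable {b : ℝ}

lemma integral_gaussian_areaMeasure (hb : 0 < b) (z : ℂ) :
    ∫ w, Real.exp (-b * ‖w - z‖ ^ 2) ∂areaMeasure = 1 / b := by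
  rw [areaMeasure, integral_smul_measure,
    integral_sub_right_eq_self (fun w : ℂ => Real.exp (-b * ‖w‖ ^ 2)) z,
    GaussianFourier.integral_rexp_neg_mul_sq_norm hb, Complex.finrank_real_complex,
    ENNReal.toReal_ofReal (by positivity), Nat.cast_ofNat, div_self two_ne_zero, Real.rpow_one,
    smul_eq_mul, ← mul_div_assoc, inv_mul_cancel₀ Real.pi_ne_zero]

lemma memLp_two_gaussian (hb : 0 < b) (z : ℂ) :
    MemLp (fun w => Real.exp (-b * ‖w - z‖ ^ 2)) 2 areaMeasure := by
  have hcont : Continuous fun w => Real.exp (-b * ‖w - z‖ ^ 2) := by fun_prop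
  refine (memLp_two_iff_integrable_sq hcont.aestronglyMeasurable).2
    (Integrable.of_integral_ne_zero ?_)
  simp only [exp_neg_mul_sq_pow_two, integral_gaussian_areaMeasure (mul_pos two_pos hb)]
  positivity

lemma memLp_two_sqrt {α : Type*} [MeasurableSpace α] {μ : Measure α} {g : α → ℝ}
    (hg : Integrable g μ) (hg₀ : 0 ≤ g) : MemLp (fun x => √(g x)) 2 μ := by
  refine (memLp_two_iff_integrable_sq
    (Real.continuous_sqrt.comp_aestronglyMeasurable hg.aestronglyMeasurable)).2 ?_
  simpa only [Real.sq_sqrt (hg₀ _)] using hg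

lemma integral_sqrt_mul_gaussian_le {g : ℂ → ℝ} (hg : Integrable g areaMeasure) (hg₀ : 0 ≤ g)
    (hb : 0 < b) (z : ℂ) :
    ∫ w, √(g w) * Real.exp (-b * ‖w - z‖ ^ 2) ∂areaMeasure
      ≤ √(∫ w, g w ∂areaMeasure) * √(1 / (2 * b)) := by
  have h := integral_mul_le_Lp_mul_Lq_of_nonneg (μ := areaMeasure) Real.HolderConjugate.two_two
    (.of_forall fun w => Real.sqrt_nonneg (g w))
    (.of_forall fun w => (Real.exp_pos (-b * ‖w - z‖ ^ 2)).le)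
    (by simpa using memLp_two_sqrt hg hg₀) (by simpa using memLp_two_gaussian hb z)
  simpa only [Real.rpow_two, Real.sq_sqrt (hg₀ _), exp_neg_mul_sq_pow_two, ← Real.sqrt_eq_rpow,
    integral_gaussian_areaMeasure (mul_pos two_pos hb)] using h

end Gaussian

section Reproducing

variable {Q : ℂ → ℝ} {P : ℂ → ℂ → ℂ} {X u : ℂ → ℂ} {z₀ z : ℂ} {r s R κ : ℝ}

lemma IsTest.mono {U V : Set ℂ} (hUV : U ⊆ V) (hX : IsTest U X) : IsTest V X :=
  ⟨hX.smooth, hX.compact, hX.supp.trans hUV⟩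

lemma pompeiuIntegrand_eq_zero_of_notMem_tsupport {G : ℂ → ℂ} {w : ℂ} (hw : w ∉ tsupport G) :
    pompeiuIntegrand u G z w = 0 := by
  rw [pompeiuIntegrand, wirtBar_eq_zero_of_notMem_tsupport hw,
    wirtBar_eq_zero_of_notMem_tsupport fun h => hw (tsupport_wirtBar_subset G h)]
  ring

namespace IsDecayingPolarization

lemma exists_norm_expPhase_mul_errorAmplitude_le (h : IsDecayingPolarization Q P z₀ r κ)
    (hX : IsTest univ X) (hone : ∀ w ∈ ball z₀ R, X w = 1) (hsR : s < R) {ρ : ℝ} (hsρ : s ≤ ρ)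
    (hρ : ρ < r) :
    ∃ C, 0 ≤ C ∧ ∀ m : ℝ, 1 ≤ m → ∀ z ∈ ball z₀ s, ∀ w ∈ closedBall z₀ ρ, w ≠ z →
      ‖expPhase Q P m z w * (errorAmplitude X P m z w / (w - z))‖
        ≤ C * Real.exp (m * Q z / 2)
          * (Real.exp (-(m * Q w) / 2) * Real.exp (-(m * (κ / 4)) * ‖w - z‖ ^ 2)) := by
  obtain ⟨C, hC, hbound⟩ := h.exists_norm_errorAmplitude_le hX hone hsR hsρ hρ
  have hκ := h.rate_pos
  set D := 1 / (κ / 4) + 2 / (κ / 4) ^ 2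
  refine ⟨C * D, by positivity, fun m hm z hz w hw hne => ?_⟩
  set t := m * ‖w - z‖ ^ 2 with ht
  have hpos : 0 < ‖w - z‖ := norm_pos_iff.2 (sub_ne_zero.2 hne)
  have hamp : ‖errorAmplitude X P m z w / (w - z)‖ ≤ C * (D * Real.exp (κ / 4 * t)) := by
    rw [norm_div, div_le_iff₀ hpos]
    calc ‖errorAmplitude X P m z w‖ ≤ C * (t + t ^ 2) * ‖w - z‖ :=
          (hbound m hm z hz w hw).trans_eq (by ring)
      _ ≤ C * (D * Real.exp (κ / 4 * t)) * ‖w - z‖ := by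
          gcongr
          exact add_sq_le_mul_exp (by positivity) (by positivity)
  rw [norm_mul]
  calc ‖expPhase Q P m z w‖ * ‖errorAmplitude X P m z w / (w - z)‖
      ≤ Real.exp (m * Q z / 2) * Real.exp (-(m * Q w) / 2) * Real.exp (-(κ / 2) * t)
        * (C * (D * Real.exp (κ / 4 * t))) := by
        gcongr
        exact h.norm_expPhase_le (by positivity)
          (ball_subset_ball (hsρ.trans hρ.le) hz) (closedBall_subset_ball hρ hw)
    _ = C * D * Real.exp (m * Q z / 2)
        * (Real.exp (-(m * Q w) / 2) * (Real.exp (-(κ / 2) * t) * Real.exp (κ / 4 * t))) := by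
        ring
    _ = C * D * Real.exp (m * Q z / 2)
        * (Real.exp (-(m * Q w) / 2) * Real.exp (-(m * (κ / 4)) * ‖w - z‖ ^ 2)) := by
        rw [← Real.exp_add, ht]
        ring_nf

lemma exists_norm_pompeiuIntegrand_add_le (h : IsDecayingPolarization Q P z₀ r κ)
    (hX : IsTest (ball z₀ r) X) (hone : ∀ w ∈ ball z₀ R, X w = 1) (hsR : s < R) (hsr : s < r) :
    ∃ C, 0 ≤ C ∧ ∀ m : ℝ, 1 ≤ m → ∀ u : ℂ → ℂ, ∀ z ∈ ball z₀ s, ∀ w ≠ z,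
      ‖pompeiuIntegrand u (testFactor X Q P m z) z w
          + u w * X w * twoTermKernel P m z w * (Real.exp (-(m * Q w)) : ℂ)‖
        ≤ C * Real.exp (m * Q z / 2) * (√(‖u w‖ ^ 2 * Real.exp (-(m * Q w)))
          * Real.exp (-(m * (κ / 4)) * ‖w - z‖ ^ 2)) := by
  obtain ⟨r', hr', hsupp⟩ := exists_lt_subset_ball (isClosed_tsupport X) hX.supp
  have hρ : max r' s < r := max_lt hr' hsr
  have hX' := hX.mono (subset_univ _)
  obtain ⟨C, hC, hbound⟩ := h.exists_norm_expPhase_mul_errorAmplitude_le hX' hone hsR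
    (le_max_right r' s) hρ
  refine ⟨C, hC, fun m hm u z hz w hne => ?_⟩
  by_cases hw : w ∈ tsupport X
  · have hwρ : w ∈ closedBall z₀ (max r' s) :=
      ball_subset_closedBall (ball_subset_ball (le_max_left _ _) (hsupp hw))
    rw [h.pompeiuIntegrand_testFactor_add hX' m u (ball_subset_ball hsr.le hz) (hX.supp hw) hne,
      norm_neg, mul_assoc, norm_mul]
    refine (mul_le_mul_of_nonneg_left (hbound m hm z hz w hwρ hne) (norm_nonneg _)).trans_eq ?_
    rw [Real.sqrt_mul (sq_nonneg _), Real.sqrt_sq (norm_nonneg _), ← Real.exp_half]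
    ring
  · have hwG : w ∉ tsupport (testFactor X Q P m z) := fun hc =>
      hw (tsupport_mul_subset_right hc)
    rw [pompeiuIntegrand_eq_zero_of_notMem_tsupport hwG, image_eq_zero_of_notMem_tsupport hw,
      mul_zero, zero_mul, zero_mul, add_zero, norm_zero]
    positivity

lemma integrable_mul_twoTermKernel (h : IsDecayingPolarization Q P z₀ r κ)
    (hX : IsTest (ball z₀ r) X) (hu : Continuous u) (m : ℝ) (hz : z ∈ ball z₀ r) :
    Integrable (fun w => u w * X w * twoTermKernel P m z w * (Real.exp (-(m * Q w)) : ℂ))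
      areaMeasure := by
  have hK : ContDiffOn ℝ ∞ (fun w => twoTermKernel P m z w * (Real.exp (-(m * Q w)) : ℂ))
      (ball z₀ r) :=
    ((h.analytic_snd m hz).contDiffOn isOpen_ball.uniqueDiffOn).mul
      (Complex.ofRealCLM.contDiff.comp_contDiffOn
        (contDiffOn_const.mul (h.analytic.contDiffOn isOpen_ball.uniqueDiffOn)).neg.exp)
  have hKX := hX.contDiffOn_mul isOpen_ball hK
  refine ((hu.mul hKX.smooth.continuous).integrable_of_hasCompactSupport
    hKX.compact.mul_left).congr (.of_forall fun w => ?_)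
  simp only [Pi.mul_apply]
  ring

lemma norm_sub_setIntegral_le (h : IsDecayingPolarization Q P z₀ r κ)
    (hX : IsTest (ball z₀ r) X) (hu : IsPolyanalyticOn 2 u univ) {m : ℝ}
    (hz : z ∈ ball z₀ r) (hXz : X z = 1) {f : ℂ → ℝ} (hf : Integrable f areaMeasure)
    (hle : ∀ w ≠ z, ‖pompeiuIntegrand u (testFactor X Q P m z) z w
      + u w * X w * twoTermKernel P m z w * (Real.exp (-(m * Q w)) : ℂ)‖ ≤ f w) :
    ‖u z - ∫ w in ball z₀ r,
        u w * X w * twoTermKernel P m z w * (Real.exp (-(m * Q w)) : ℂ) ∂areaMeasure‖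
      ≤ ∫ w, f w ∂areaMeasure := by
  have huc : Continuous u := continuousOn_univ.1 hu.1
  have hG : IsTest univ (testFactor X Q P m z) :=
    (h.isTest_testFactor hX m hz).mono (subset_univ _)
  have hrep := hu.mul_eq_neg_integral_pompeiuIntegrand hG z
  rw [h.testFactor_self m hz, hXz, mul_one] at hrep
  rw [setIntegral_eq_integral_of_forall_compl_eq_zero fun w hw => by
      rw [hX.eq_zero_of_notMem hw, mul_zero, zero_mul, zero_mul],
    hrep, ← neg_add', norm_neg, ← integral_add (integrable_pompeiuIntegrand huc hG z)
      (h.integrable_mul_twoTermKernel hX huc m hz)]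
  refine norm_integral_le_of_norm_le hf ?_
  filter_upwards [(countable_singleton z).ae_notMem areaMeasure] with w hw using hle w hw

lemma exists_norm_sub_setIntegral_le (h : IsDecayingPolarization Q P z₀ r κ)
    (hX : IsTest (ball z₀ r) X) (hone : ∀ w ∈ ball z₀ R, X w = 1) (hsR : s < R) (hsr : s < r) :
    ∃ C, ∀ m : ℝ, 1 ≤ m → ∀ u ∈ bergmanSpace 2 m Q, ∀ z ∈ ball z₀ s,
      ‖u z - ∫ w in ball z₀ r,
          u w * X w * twoTermKernel P m z w * (Real.exp (-(m * Q w)) : ℂ) ∂areaMeasure‖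
        ≤ C * (weightedNorm m Q u * Real.exp (m * Q z / 2) * m ^ (-(1 / 2) : ℝ)) := by
  obtain ⟨C, hC, hbound⟩ := h.exists_norm_pompeiuIntegrand_add_le hX hone hsR hsr
  have hκ := h.rate_pos
  refine ⟨C * √(1 / (2 * (κ / 4))), fun m hm u hu z hz => ?_⟩
  have hm₀ : 0 < m := zero_lt_one.trans_le hm
  have hg₀ : (0 : ℂ → ℝ) ≤ fun w => ‖u w‖ ^ 2 * Real.exp (-(m * Q w)) := fun w => by positivity
  have hb : 0 < m * (κ / 4) := by positivity
  have hroot : √(1 / (2 * (m * (κ / 4)))) = √(1 / (2 * (κ / 4))) * m ^ (-(1 / 2) : ℝ) := by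
    rw [Real.rpow_neg hm₀.le, ← Real.sqrt_eq_rpow, ← Real.sqrt_inv,
      ← Real.sqrt_mul (by positivity)]
    congr 1
    field_simp
  refine (h.norm_sub_setIntegral_le hX hu.1 (ball_subset_ball hsr.le hz)
    (hone z (ball_subset_ball hsR.le hz))
    (((memLp_two_sqrt hu.2 hg₀).integrable_mul (memLp_two_gaussian hb z)).const_mul _)
    (hbound m hm u z hz)).trans ?_
  rw [integral_const_mul]
  calc _ ≤ C * Real.exp (m * Q z / 2) * (weightedNorm m Q u * √(1 / (2 * (m * (κ / 4))))) := by
        gcongr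
        exact integral_sqrt_mul_gaussian_le hu.2 hg₀ hb z
    _ = _ := by
        rw [hroot]
        ring

end IsDecayingPolarization

end Reproducing

end LocalBergman

theorem mainTheorem7_general {Q : ℂ → ℝ} {P : ℂ → ℂ → ℂ} {z₀ : ℂ} {r κ : ℝ} {χ₀ : ℝ → ℝ}
    (hr : 0 < r) (h : LocalBergman.IsDecayingPolarization Q P z₀ r κ)
    (hχ : LocalBergman.IsCutoffProfile χ₀) :
    LocalBergman.IsLocalBergmanKernel 2 Q z₀ r χ₀ (fun m => m ^ (-(1 / 2) : ℝ))
      (LocalBergman.twoTermKernel P) where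
  polyanalytic_fst m _ _ hw := h.polyanalytic_fst m hw
  analytic_snd m _ _ hz := h.analytic_snd m hz
  reproducing := by
    have hone : ∀ w ∈ Metric.ball z₀ (2 * r / 3), (LocalBergman.cutoff χ₀ z₀ r w : ℂ) = 1 :=
      fun w hw => by rw [hχ.cutoff_eq_one hw, Complex.ofReal_one]
    exact h.exists_norm_sub_setIntegral_le (hχ.isTest_cutoff z₀ hr) hone (by linarith)
      (by linarith)
  conjPolyanalytic_snd m _ _ hz := h.conjPolyanalytic_snd m hz

end

theorem mainTheorem7 (Q : ℂ → ℝ) (hQ : Continuous Q) (P : ℂ → ℂ → ℂ) (z₀ : ℂ) (r : ℝ)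
    (hr : LocalBergman.IsAdmissible Q P z₀ r)
    (χ₀ : ℝ → ℝ) (hχ : LocalBergman.IsCutoffProfile χ₀) :
    LocalBergman.IsLocalBergmanKernel 2 Q z₀ r χ₀ (fun m => m ^ (-(1 / 2) : ℝ))
      (LocalBergman.twoTermKernel P) :=
  mainTheorem7_general hr.radius_pos hr.isDecayingPolarization hχ
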